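/- **Final payoff improvement guarantee.** Let $\mathcal S\subseteq\mathbb R^n$ be open and convex, $\mathcal A\subseteq\mathbb R^m$ convex, and let $(\mathcal S,\mathcal A,P,R,\mu,\gamma)$ be a discounted Markov decision process: $P$ is a Markov kernel from $\mathcal S\times\mathcal A$ to $\mathcal S$, $R:\mathcal S\times\mathcal A\to[0,R_{\max}]$ is measurable, $\mu$ is the initial state distribution and $\gamma\in[0,1)$. A policy is a Markov kernel $\pi$ from $\mathcal S$ to $\mathcal A$. For a state distribution $\nu$ put $\mathbb P(\nu,\pi)=\mathbb E_{s\sim\nu,\,a\sim\pi(s)}[P(s,a)]$, $\mathbb P^0(\nu,\pi)=\nu$, $\mathbb P^{t+1}(\nu,\pi)=\mathbb P(\mathbb P^{t}(\nu,\pi),\pi)$, and $$\rho^\pi=(1-\gamma)\sum_{t\ge0}\gamma^t\,\mathbb P^t(\mu,\pi),\qquad V^\pi(s)=\mathbb E\Big[\sum_{t\ge0}\gamma^tR(s_t,a_t)\,\Big|\,s_0=s,\ a_t\sim\pi(s_t),\ s_{t+1}\sim P(s_t,a_t)\Big],$$ $$Q^\pi(s,a)=R(s,a)+\gamma\,\mathbb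 E_{s'\sim P(s,a)}[V^\pi(s')],\qquad A^\pi(s,\pi')=\mathbb E_{a\sim\pi'(s)}[Q^\pi(s,a)-V^\pi(s)],\qquad \eta_\pi=\mathbb E_{s\sim\mu}[V^\pi(s)].$$ $W$ denotes the ($1$-)Wasserstein distance for the Euclidean distance, with values in $[0,\infty]$, and $W(\pi_1,\pi_2)=\sup_sW(\pi_1(\cdot|s),\pi_2(\cdot|s))$. For a differentiable function $f$ put $\mathrm{Lip}(f;x)=\sup_x\|\nabla_xf\|_2$. Let $\pi_1,\pi_2$ be policies and $L_\pi\ge0$, $L\in\mathbb R$. Assume: 1. $Q^{\pi_1}(s,a)$ is differentiable in $a$ and in $s$, the partial derivatives $\partial_{s^{(j)}}Q^{\pi_1}(s,a)$ are differentiable in $a$, and the constants $$\sup_s\mathrm{Lip}(Q^{\pi_1}(s,a);a)\quad\text{and}\quad\sup_s\|\mathrm{Lip}(\nabla_sQ^{\pi_1}(s,a);a)\|_2$$ are finite; here $\mathrm{Lip}(\nabla_sQ^{\pi_1}(s,a);a)$ is the vector of the constants $\mathrm{Lip}(\partial_{s^{(j)}}Q^{\pi_1}(s,a);a)$, $j=1,\dots,n$.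 2. $W(\mathbb P(\nu,\pi_1),\mathbb P(\nu,\pi_2))\le L_\pi\,W(\pi_1,\pi_2)$ for all state distributions $\nu$. 3. One of the following holds. * (Lipschitz in the state distribution) $L=L_\mu\ge0$ with $\gamma L_\mu<1$, and $W(\mathbb P(\nu_1,\pi),\mathbb P(\nu_2,\pi))\le L_\mu\,W(\nu_1,\nu_2)$ for all state distributions $\nu_1,\nu_2$ and $\pi\in\{\pi_1,\pi_2\}$. * (Stability) $|\gamma L|<1$ and $C_L:=\sup_t\sum_{k=1}^t\hat L^{(t-k)}\prod_{i=1}^{k-1}\tilde L^{(t-i)}\le L_\pi\sum_{t\ge0}(\gamma L)^t$. Here, with $\nu_{i}=\mathbb P^t(\mu,\pi_i)$, $\tilde L^{(t)}$ and $\hat L^{(t)}$ are the infima of the numbers in $[0,\infty]$ satisfying $W(\mathbb P(\nu_1,\pi_2),\mathbb P(\nu_2,\pi_2))=\tilde L^{(t)}\,W(\nu_1,\nu_2)$ and $W(\mathbb P(\nu_1,\pi_1),\mathbb P(\nu_1,\pi_2))=\hat L^{(t)}\,W(\pi_1,\pi_2)$, respectively. Put $$C_1'=\sup_s\frac{2\,\mathrm{Lip}(Q^{\pi_1}(s,a);a)\,\gamma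 L_\pi}{(1-\gamma)(1-\gamma L)},\qquad C_2'=\sup_s\frac{\|\mathrm{Lip}(\nabla_sQ^{\pi_1}(s,a);a)\|_2\,\gamma L_\pi}{(1-\gamma)(1-\gamma L)},$$ and, for an arbitrary real $\alpha\ne0$, $C_1=\tfrac{\alpha^2}{2}C_1'$ and $C_2=C_2'+\tfrac{1}{2\alpha^2}C_1'$. Let $$\mathcal L_{G^2}(\pi_1,\pi_2;s)=\Big\|\nabla_{s'}W\Big(\tfrac{\pi_2(\cdot|s')+\pi_1(\cdot|s)}2,\tfrac{\pi_2(\cdot|s)+\pi_1(\cdot|s')}2\Big)\Big|_{s'=s}\Big\|_2^2=\sum_{j=1}^n\bigg(\limsup_{h\to0}\frac1{|h|}W\Big(\tfrac{\pi_2(\cdot|s+he_j)+\pi_1(\cdot|s)}2,\tfrac{\pi_2(\cdot|s)+\pi_1(\cdot|s+he_j)}2\Big)\bigg)^2 ,$$ where the right-hand side is the meaning of the middle expression (the function of $s'$ is nonnegative and vanishes at $s'=s$, where it generally has a kink). Then $$\eta_{\pi_2}\ \ge\ \eta_{\pi_1}+\frac1{1-\gamma}\,\mathbb E_{s\sim\rho^{\pi_1}}\big[A^{\pi_1}(s,\pi_2)\big]-C_1\,\sup_s\mathcal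 L_{G^2}(\pi_1,\pi_2;s)-C_2\,\sup_sW(\pi_2(\cdot|s),\pi_1(\cdot|s))^2,$$ where the right-hand side is $-\infty$ if a subtracted term is infinite, and $0\cdot\infty=0$. -/

import Mathlib

open MeasureTheory ProbabilityTheory Filter Topology
open scoped ENNReal NNReal

noncomputable section

namespace TDPO

/-! ### Wasserstein distance -/

/-- The Wasserstein distance `W(ζ, ν)`: infimum over all couplings `c` of `ζ` and `ν` of
`∫ ‖x - y‖ dc(x, y)`, with values in `[0, ∞]`. -/
def W {X : Type*} [PseudoEMetricSpace X] [MeasurableSpace X] (ζ ν : Measure X) : ℝ≥0∞ :=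
  ⨅ (c : Measure (X × X)) (_ : c.map Prod.fst = ζ ∧ c.map Prod.snd = ν),
    ∫⁻ p, edist p.1 p.2 ∂c

/-- The policy distance `W(π₁, π₂) = sup_s W(π₁(·|s), π₂(·|s))`. -/
def policyW {X Y : Type*} [MeasurableSpace X] [PseudoEMetricSpace Y] [MeasurableSpace Y]
    (π₁ π₂ : Kernel X Y) : ℝ≥0∞ :=
  ⨆ s, W (π₁ s) (π₂ s)

/-! ### Markov decision processes -/

/-- A discounted Markov decision process `(X, Y, P, R, μ, γ)` with state space `X`, action space
`Y` and a reward with values in `[0, Rmax]`. A policy is a Markov kernel from `X` to `Y`. -/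
structure MDP (X Y : Type*) [MeasurableSpace X] [MeasurableSpace Y] where
  /-- transition dynamics -/
  P : Kernel (X × Y) X
  markov : IsMarkovKernel P
  /-- reward -/
  R : X → Y → ℝ
  measurable_R : Measurable fun p : X × Y => R p.1 p.2
  /-- upper bound of the reward -/
  Rmax : ℝ
  R_nonneg : ∀ s a, 0 ≤ R s a
  R_le : ∀ s a, R s a ≤ Rmax
  /-- initial state distribution -/
  μ : Measure X
  prob : IsProbabilityMeasure μ
  /-- discount factor -/
  γ : ℝ
  γ_nonneg : 0 ≤ γ
  γ_lt_one : γ < 1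

namespace MDP

variable {X Y : Type*} [MeasurableSpace X] [MeasurableSpace Y] (M : MDP X Y)

/-- `ℙ(ν, π)`: the law of `s' ∼ P(s, a)` with `s ∼ ν` and `a ∼ π(s)`. -/
def step (π : Kernel X Y) (ν : Measure X) : Measure X :=
  ν.bind (M.P ∘ₖ (Kernel.id ×ₖ π))

/-- The `t`-step dynamics `ℙᵗ(ν, π)`. -/
def stepN (π : Kernel X Y) (ν : Measure X) : ℕ → Measure X
  | 0 => ν
  | t + 1 => M.step π (stepN π ν t)

/-- The discounted visitation frequency `(1 - γ) ∑ₜ γᵗ ℙᵗ(ν, π)`. -/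
def visitation (π : Kernel X Y) (ν : Measure X) : Measure X :=
  ENNReal.ofReal (1 - M.γ) • Measure.sum fun t => ENNReal.ofReal (M.γ ^ t) • M.stepN π ν t

/-- The value function: the expectation of `∑ₜ γᵗ R(sₜ, aₜ)` with `s₀ = s`, `aₜ ∼ π(sₜ)` and
`sₜ₊₁ ∼ P(sₜ, aₜ)`. -/
def V (π : Kernel X Y) (s : X) : ℝ :=
  ∑' t : ℕ, M.γ ^ t * ∫ s', ∫ a, M.R s' a ∂(π s') ∂(M.stepN π (Measure.dirac s) t)

/-- The action-value function. -/
def Q (π : Kernel X Y) (s : X) (a : Y) : ℝ :=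
  M.R s a + M.γ * ∫ s', M.V π s' ∂(M.P (s, a))

/-- The advantage `A^π(s, π')` of the policy `π'` over the policy `π`. -/
def adv (π : Kernel X Y) (s : X) (π' : Kernel X Y) : ℝ :=
  ∫ a, (M.Q π s a - M.V π s) ∂(π' s)

/-- The payoff of a policy. -/
def payoff (π : Kernel X Y) : ℝ := ∫ s, M.V π s ∂M.μ

/-! ### Lipschitz and stability properties of the dynamics -/

/-- The dynamics is Wasserstein-Lipschitz in the policy, for the policies `π₁` and `π₂`. -/
def PolicyLipschitz [PseudoEMetricSpace X] [PseudoEMetricSpace Y] (π₁ π₂ : Kernel X Y)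
    (L : ℝ≥0) : Prop :=
  ∀ ν : Measure X, IsProbabilityMeasure ν →
    W (M.step π₁ ν) (M.step π₂ ν) ≤ L * policyW π₁ π₂

/-- The dynamics under the policy `π` is Wasserstein-Lipschitz in the state distribution. -/
def StateLipschitz [PseudoEMetricSpace X] (π : Kernel X Y) (L : ℝ≥0) : Prop :=
  ∀ ν₁ ν₂ : Measure X, IsProbabilityMeasure ν₁ → IsProbabilityMeasure ν₂ →
    W (M.step π ν₁) (M.step π ν₂) ≤ L * W ν₁ ν₂

/-- The expansion rate `L̃⁽ᵗ⁾` of the state distribution: the least `L ≥ 0` with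
`W(ℙ(ν₁, π₂), ℙ(ν₂, π₂)) = L W(ν₁, ν₂)`, where `νᵢ = ℙᵗ(μ, πᵢ)`. -/
def rateState [PseudoEMetricSpace X] (π₁ π₂ : Kernel X Y) (t : ℕ) : ℝ≥0∞ :=
  sInf {L | W (M.step π₂ (M.stepN π₁ M.μ t)) (M.step π₂ (M.stepN π₂ M.μ t)) =
    L * W (M.stepN π₁ M.μ t) (M.stepN π₂ M.μ t)}

/-- The expansion rate `L̂⁽ᵗ⁾` in the policy: the least `L ≥ 0` with
`W(ℙ(ν, π₁), ℙ(ν, π₂)) = L W(π₁, π₂)`, where `ν = ℙᵗ(μ, π₁)`. -/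
def ratePolicy [PseudoEMetricSpace X] [PseudoEMetricSpace Y] (π₁ π₂ : Kernel X Y) (t : ℕ) :
    ℝ≥0∞ :=
  sInf {L | W (M.step π₁ (M.stepN π₁ M.μ t)) (M.step π₂ (M.stepN π₁ M.μ t)) =
    L * policyW π₁ π₂}

/-- `C_L = sup_t ∑_{k=1}^t L̂⁽ᵗ⁻ᵏ⁾ ∏_{i=1}^{k-1} L̃⁽ᵗ⁻ⁱ⁾`. The dynamics is stable along the
two policies when this is finite. -/
def stabilityConst [PseudoEMetricSpace X] [PseudoEMetricSpace Y] (π₁ π₂ : Kernel X Y) : ℝ≥0∞ :=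
  ⨆ t : ℕ, ∑ k ∈ Finset.Icc 1 t,
    M.ratePolicy π₁ π₂ (t - k) * ∏ i ∈ Finset.Icc 1 (k - 1), M.rateState π₁ π₂ (t - i)

end MDP

/-! ### Gradients and Lipschitz constants on subsets of Euclidean spaces -/

open Classical in
/-- Extension by zero of a function on a set `D`; only used for derivatives at points of `D`
(taken within `D`, or with `D` open), so that the values off `D` play no role. -/
def zeroExt {E : Type*} (D : Set E) (f : D → ℝ) (x : E) : ℝ :=
  if h : x ∈ D then f ⟨x, h⟩ else 0

/-- `f` is differentiable on its domain `D`. -/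
def DiffOn {d : ℕ} (D : Set (EuclideanSpace ℝ (Fin d))) (f : D → ℝ) : Prop :=
  DifferentiableOn ℝ (zeroExt D f) D

/-- `Lip(f; x) = sup_x ‖∇f(x)‖₂`; the operator norm of the derivative is the Euclidean norm of
the gradient. -/
def Lip {d : ℕ} (D : Set (EuclideanSpace ℝ (Fin d))) (f : D → ℝ) : ℝ≥0∞ :=
  ⨆ x : D, ‖fderivWithin ℝ (zeroExt D f) D x‖ₑ

/-- The partial derivative `∂f/∂s⁽ʲ⁾` at a point of the open set `S`. -/
def pderiv {n : ℕ} (S : Set (EuclideanSpace ℝ (Fin n))) (f : S → ℝ) (s : S) (j : Fin n) : ℝ :=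
  fderiv ℝ (zeroExt S f) s (EuclideanSpace.single j 1)

variable {n m : ℕ} {S : Set (EuclideanSpace ℝ (Fin n))} {A : Set (EuclideanSpace ℝ (Fin m))}

/-- `‖Lip(∇ₛ q(s, a); a)‖₂`: the Euclidean norm of the vector of the Lipschitz constants in `a` of
the components of `∇ₛ q(s, a)`. -/
def lipGrad (q : S → A → ℝ) (s : S) : ℝ≥0∞ :=
  (∑ j : Fin n, Lip A (fun a => pderiv S (fun s' => q s' a) s j) ^ 2) ^ (1 / 2 : ℝ)

/-- `W((π₂(·|s') + π₁(·|s))/2, (π₂(·|s) + π₁(·|s'))/2)`. -/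
def mixW (π₁ π₂ : Kernel S A) (s s' : S) : ℝ≥0∞ :=
  W ((2⁻¹ : ℝ≥0∞) • (π₂ s' + π₁ s)) ((2⁻¹ : ℝ≥0∞) • (π₂ s + π₁ s'))

open Classical in
/-- The size of the `j`-th partial derivative of `s' ↦ mixW π₁ π₂ s s'` at `s' = s`. Since this
function is nonnegative and vanishes at `s' = s`, it typically has a kink there, and the derivative
is the limit of the quotients `mixW π₁ π₂ s (s + h eⱼ) / |h|` as `h → 0`, taken as an upper limit
so that it always makes sense in `[0, ∞]`. The value off the open set `S` plays no role. -/
def mixPartial (π₁ π₂ : Kernel S A) (s : S) (j : Fin n) : ℝ≥0∞ :=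
  limsup (fun h : ℝ =>
    if hs : (s : EuclideanSpace ℝ (Fin n)) + h • EuclideanSpace.single j 1 ∈ S then
      mixW π₁ π₂ s ⟨_, hs⟩ / ‖h‖ₑ
    else 0) (𝓝[≠] 0)

/-- `L_{G²}(π₁, π₂; s)`: the squared Euclidean norm of the gradient of `mixW π₁ π₂ s` at `s`. -/
def LG2 (π₁ π₂ : Kernel S A) (s : S) : ℝ≥0∞ :=
  ∑ j : Fin n, mixPartial π₁ π₂ s j ^ 2

/-! ### The coefficients and the lower bound -/

/-- `C₁' = sup_s 2 Lip(Q^{π₁}(s, a); a) γ L_π / ((1 - γ)(1 - γ L))`. -/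
def C₁' (M : MDP S A) (π₁ : Kernel S A) (Lπ : ℝ≥0) (L : ℝ) : ℝ≥0∞ :=
  ⨆ s, 2 * Lip A (M.Q π₁ s) * ENNReal.ofReal (M.γ * Lπ / ((1 - M.γ) * (1 - M.γ * L)))

/-- `C₂' = sup_s ‖Lip(∇ₛ Q^{π₁}(s, a); a)‖₂ γ L_π / ((1 - γ)(1 - γ L))`. -/
def C₂' (M : MDP S A) (π₁ : Kernel S A) (Lπ : ℝ≥0) (L : ℝ) : ℝ≥0∞ :=
  ⨆ s, lipGrad (M.Q π₁) s * ENNReal.ofReal (M.γ * Lπ / ((1 - M.γ) * (1 - M.γ * L)))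

/-- `C₁ = C₁' α² / 2`. -/
def C₁ (M : MDP S A) (π₁ : Kernel S A) (Lπ : ℝ≥0) (L α : ℝ) : ℝ≥0∞ :=
  C₁' M π₁ Lπ L * ENNReal.ofReal (α ^ 2 / 2)

/-- `C₂ = C₂' + C₁' / (2 α²)`. -/
def C₂ (M : MDP S A) (π₁ : Kernel S A) (Lπ : ℝ≥0) (L α : ℝ) : ℝ≥0∞ :=
  C₂' M π₁ Lπ L + C₁' M π₁ Lπ L * ENNReal.ofReal (1 / (2 * α ^ 2))

/-- The surrogate
`η_{π₁} + (1 - γ)⁻¹ E_{s ∼ ρ^{π₁}}[A^{π₁}(s, π₂)] - C₁ sup_s L_{G²} - C₂ sup_s W(π₂, π₁)²`,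
which is `-∞` when a subtracted term is infinite. -/
def surrogate (M : MDP S A) (π₁ π₂ : Kernel S A) (Lπ : ℝ≥0) (L α : ℝ) : EReal :=
  ((M.payoff π₁ + 1 / (1 - M.γ) * ∫ s, M.adv π₁ s π₂ ∂(M.visitation π₁ M.μ) : ℝ) : EReal)
    - ((C₁ M π₁ Lπ L α * ⨆ s, LG2 π₁ π₂ s : ℝ≥0∞) : EReal)
    - ((C₂ M π₁ Lπ L α * ⨆ s, W (π₂ s) (π₁ s) ^ 2 : ℝ≥0∞) : EReal)

end TDPO

end

/-!
By the performance difference identity, the payoff of `π₂` differs from the surrogate payoff only in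
that the advantage `s ↦ A^{π₁}(s, π₂)` is averaged over the state distributions of `π₁` instead of
those of `π₂`. The easy half of Kantorovich duality bounds the difference by the Lipschitz constant
of the advantage times the discounted sum of the distances between these distributions, and a
recursion in `t` bounds that sum by a multiple of `policyW π₁ π₂`.

Since `A^{π₁}(s, π₂) = ∫ Q^{π₁}(s, a) d(π₂(·|s) - π₁(·|s))`, a small move of `s` along a coordinate
axis changes it in two ways: the move of the measures costs at most twice
`Lip(Q^{π₁}(s, a); a) * mixW π₁ π₂ s s'`, and the move of the integrand at most
`Lip(∂ⱼ Q^{π₁}(s, a); a) * W(π₂(·|s), π₁(·|s))` per unit length. These slopes are taken along the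
axes only, but a function whose axis slopes are bounded is locally Lipschitz, hence differentiable
almost everywhere by Rademacher's theorem, and so its Lipschitz constant is at most the Euclidean
norm of the slopes. The inequality of arithmetic and geometric means, weighted by `α ^ 2`, then
separates the product of the square root of `L_{G²}` and the distance of the policies.
-/

namespace TDPO

/-! ### Wasserstein distance: couplings and duality -/

/-- The transport plans over which the infimum `W ζ ν` is taken: `c` is a coupling of `ζ` and `ν`
when these are its two marginals. -/
structure IsCoupling {X : Type*} [MeasurableSpace X] (c : Measure (X × X)) (ζ ν : Measure X) :
    Prop where
  map_fst : c.map Prod.fst = ζ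
  map_snd : c.map Prod.snd = ν

section Coupling

variable {X : Type*} [MeasurableSpace X] {c : Measure (X × X)} {ζ ν : Measure X}

lemma isCoupling_prod (ζ ν : Measure X) [IsProbabilityMeasure ζ] [IsProbabilityMeasure ν] :
    IsCoupling (ζ.prod ν) ζ ν :=
  ⟨by simp [Measure.map_fst_prod], by simp [Measure.map_snd_prod]⟩

lemma isCoupling_diag (ζ : Measure X) : IsCoupling (ζ.map fun x => (x, x)) ζ ζ := by
  have hd : Measurable fun x : X => (x, x) := by fun_prop
  exact ⟨(Measure.map_map measurable_fst hd).trans Measure.map_id,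
    (Measure.map_map measurable_snd hd).trans Measure.map_id⟩

namespace IsCoupling

lemma isProbabilityMeasure [IsProbabilityMeasure ζ] (h : IsCoupling c ζ ν) :
    IsProbabilityMeasure c := by
  constructor
  rw [← Set.preimage_univ (f := Prod.fst), ← Measure.map_apply measurable_fst .univ, h.map_fst,
    measure_univ]

lemma swap (h : IsCoupling c ζ ν) : IsCoupling (c.map Prod.swap) ν ζ :=
  ⟨(Measure.map_map measurable_fst measurable_swap).trans h.map_snd,
    (Measure.map_map measurable_snd measurable_swap).trans h.map_fst⟩

variable {E : Type*} [NormedAddCommGroup E] {g : X → E}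

lemma integrable_fst (h : IsCoupling c ζ ν) (hg : Integrable g ζ) :
    Integrable (fun p => g p.1) c :=
  Integrable.comp_measurable (h.map_fst.symm ▸ hg) measurable_fst

lemma integrable_snd (h : IsCoupling c ζ ν) (hg : Integrable g ν) :
    Integrable (fun p => g p.2) c :=
  Integrable.comp_measurable (h.map_snd.symm ▸ hg) measurable_snd

lemma integral_sub_integral [NormedSpace ℝ E] (h : IsCoupling c ζ ν) (hζ : Integrable g ζ)
    (hν : Integrable g ν) :
    ∫ x, g x ∂ζ - ∫ x, g x ∂ν = ∫ p, (g p.1 - g p.2) ∂c := by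
  rw [integral_sub (h.integrable_fst hζ) (h.integrable_snd hν)]
  obtain ⟨rfl, rfl⟩ := h
  rw [integral_map measurable_fst.aemeasurable hζ.aestronglyMeasurable,
    integral_map measurable_snd.aemeasurable hν.aestronglyMeasurable]

end IsCoupling

lemma exists_gluing {X : Type*} [MeasurableSpace X] [StandardBorelSpace X]
    {c d : Measure (X × X)} {ζ ν ξ : Measure X} [IsProbabilityMeasure ζ] [IsProbabilityMeasure ν]
    (hc : IsCoupling c ζ ν) (hd : IsCoupling d ν ξ) :
    ∃ e : Measure ((X × X) × X), e.map Prod.fst = c ∧ e.map (fun p => (p.1.2, p.2)) = d := by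
  have : Nonempty X := nonempty_of_isProbabilityMeasure ν
  have := hc.isProbabilityMeasure
  have := hd.isProbabilityMeasure
  have hdisint : d = ν ⊗ₘ d.condKernel := by
    conv_lhs => rw [← d.disintegrate d.condKernel, Measure.fst, hd.map_fst]
  have hproj : Measurable fun p : (X × X) × X => (p.1.2, p.2) := by fun_prop
  refine ⟨c ⊗ₘ Kernel.prodMkLeft X d.condKernel, Measure.fst_compProd c _, ?_⟩
  ext s hs
  rw [Measure.map_apply hproj hs, Measure.compProd_apply (hproj hs)]
  conv_rhs => rw [hdisint, Measure.compProd_apply hs, ← hc.map_snd,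
    lintegral_map (Kernel.measurable_kernel_prodMk_left hs) measurable_snd]
  rfl

end Coupling

section Wasserstein

variable {X : Type*} [MeasurableSpace X] [PseudoEMetricSpace X] {ζ ν ξ : Measure X}

lemma W_le_lintegral_edist {c : Measure (X × X)} (h : IsCoupling c ζ ν) :
    W ζ ν ≤ ∫⁻ p, edist p.1 p.2 ∂c :=
  iInf₂_le c ⟨h.map_fst, h.map_snd⟩

lemma le_W {x : ℝ≥0∞} (h : ∀ c, IsCoupling c ζ ν → x ≤ ∫⁻ p, edist p.1 p.2 ∂c) : x ≤ W ζ ν :=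
  le_iInf₂ fun c hc => h c ⟨hc.1, hc.2⟩

lemma exists_isCoupling_mul_lintegral_ne_top [IsProbabilityMeasure ζ] [IsProbabilityMeasure ν]
    {K : ℝ≥0} (hK : K * W ζ ν ≠ ⊤) :
    ∃ c, IsCoupling c ζ ν ∧ K * ∫⁻ p, edist p.1 p.2 ∂c ≠ ⊤ := by
  rcases eq_or_ne K 0 with rfl | hK0
  · exact ⟨_, isCoupling_prod ζ ν, by simp⟩
  · by_contra! h
    refine hK (eq_top_iff.2 ?_)
    have hW : W ζ ν = ⊤ := eq_top_iff.2 <| le_W fun c hc =>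
      (not_imp_comm.1 (ENNReal.mul_ne_top ENNReal.coe_ne_top) (by simpa using h c hc)).ge
    simp [hW, hK0]

/-- Only the couplings `c` with `K * ∫⁻ p, edist p.1 p.2 ∂c ≠ ⊤` matter: for `K = 0` these are all
couplings, and otherwise the ones of finite cost. -/
lemma le_mul_W [IsProbabilityMeasure ζ] [IsProbabilityMeasure ν] {K : ℝ≥0} {Λ x : ℝ≥0∞}
    (hΛ : Λ ≠ ⊤) (hK : K * W ζ ν ≠ ⊤)
    (h : ∀ c, IsCoupling c ζ ν → K * ∫⁻ p, edist p.1 p.2 ∂c ≠ ⊤ →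
      x ≤ Λ * ∫⁻ p, edist p.1 p.2 ∂c) : x ≤ Λ * W ζ ν := by
  rcases eq_or_ne Λ 0 with rfl | hΛ0
  · obtain ⟨c, hc, hcK⟩ := exists_isCoupling_mul_lintegral_ne_top hK
    simpa using h c hc hcK
  · rw [← ENNReal.div_le_iff' hΛ0 hΛ]
    refine le_W fun c hc => ?_
    by_cases hcost : ∫⁻ p, edist p.1 p.2 ∂c = ⊤
    · exact hcost ▸ le_top
    · exact (ENNReal.div_le_iff' hΛ0 hΛ).2
        (h c hc (ENNReal.mul_ne_top ENNReal.coe_ne_top hcost))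

variable [OpensMeasurableSpace X] [SecondCountableTopology X]

lemma W_comm_le (ζ ν : Measure X) : W ζ ν ≤ W ν ζ := by
  refine le_W fun c hc => (W_le_lintegral_edist hc.swap).trans_eq ?_
  rw [lintegral_map measurable_edist measurable_swap]
  simp [edist_comm]

lemma W_comm (ζ ν : Measure X) : W ζ ν = W ν ζ :=
  le_antisymm (W_comm_le _ _) (W_comm_le _ _)

lemma W_self (ζ : Measure X) : W ζ ζ = 0 := by
  refine nonpos_iff_eq_zero.1 ((W_le_lintegral_edist (isCoupling_diag ζ)).trans_eq ?_)
  rw [lintegral_map measurable_edist (by fun_prop)]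
  simp

lemma policyW_comm {S : Type*} [MeasurableSpace S] (π₁ π₂ : Kernel S X) :
    policyW π₁ π₂ = policyW π₂ π₁ :=
  iSup_congr fun s => W_comm (π₁ s) (π₂ s)

lemma enorm_integral_sub_integral_le_of_lipschitzWith {E : Type*} [NormedAddCommGroup E]
    [NormedSpace ℝ E] [IsProbabilityMeasure ζ] [IsProbabilityMeasure ν] {g : X → E} {K : ℝ≥0}
    (hg : LipschitzWith K g) (hζ : Integrable g ζ) (hν : Integrable g ν) :
    ‖∫ x, g x ∂ζ - ∫ x, g x ∂ν‖ₑ ≤ K * W ζ ν := by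
  refine le_mul_W (K := 0) ENNReal.coe_ne_top (by simp) fun c hc _ => ?_
  calc ‖∫ x, g x ∂ζ - ∫ x, g x ∂ν‖ₑ
      = ‖∫ p, (g p.1 - g p.2) ∂c‖ₑ := by rw [hc.integral_sub_integral hζ hν]
    _ ≤ ∫⁻ p, ‖g p.1 - g p.2‖ₑ ∂c := enorm_integral_le_lintegral_enorm _
    _ ≤ ∫⁻ p, K * edist p.1 p.2 ∂c :=
        lintegral_mono fun p => (edist_eq_enorm_sub (g p.1) (g p.2)).symm.trans_le (hg _ _)
    _ = K * ∫⁻ p, edist p.1 p.2 ∂c := lintegral_const_mul _ measurable_edist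

-- A closed set is approximated by its thickened indicators, which are Lipschitz.
lemma eq_of_W_eq_zero {X : Type*} [MeasurableSpace X] [PseudoEMetricSpace X] [BorelSpace X]
    [SecondCountableTopology X] {ζ ν : Measure X} [IsProbabilityMeasure ζ]
    [IsProbabilityMeasure ν] (h : W ζ ν = 0) : ζ = ν := by
  have integral_eq (g : X → ℝ≥0) (K : ℝ≥0) (hg : LipschitzWith K g) (hg1 : ∀ x, g x ≤ 1) :
      ∫ x, (g x : ℝ) ∂ζ = ∫ x, (g x : ℝ) ∂ν := by
    have hint (ξ : Measure X) [IsProbabilityMeasure ξ] : Integrable (fun x => (g x : ℝ)) ξ :=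
      .of_bound (by have := hg.continuous.measurable; fun_prop) 1
        (.of_forall fun x => by simpa using hg1 x)
    have := enorm_integral_sub_integral_le_of_lipschitzWith
      (isometry_subtype_coe.lipschitz.comp hg) (hint ζ) (hint ν)
    rwa [h, mul_zero, nonpos_iff_eq_zero, enorm_eq_zero, sub_eq_zero] at this
  have measure_eq (F : Set X) (hF : IsClosed F) : ζ F = ν F := by
    have hpos (n : ℕ) : (0 : ℝ) < 1 / (n + 1) := by positivity
    have hlim := tendsto_one_div_add_atTop_nhds_zero_nat (𝕜 := ℝ)
    have hζ := tendsto_integral_thickenedIndicator_of_isClosed ζ hF hpos hlim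
    have hν := tendsto_integral_thickenedIndicator_of_isClosed ν hF hpos hlim
    refine (measureReal_eq_measureReal_iff).1 (tendsto_nhds_unique (hζ.congr fun n => ?_) hν)
    exact integral_eq _ _ (lipschitzWith_thickenedIndicator (hpos n) F)
      (thickenedIndicator_le_one (hpos n) F)
  refine ext_of_generate_finite _ ?_ isPiSystem_isClosed (fun F hF => measure_eq F hF) (by simp)
  rw [BorelSpace.measurable_eq (α := X), borel_eq_generateFrom_isClosed]

-- For `K = ⊤` the right-hand side is finite only if `W ζ ν = 0`, where `0 * ⊤ = 0`.
lemma enorm_integral_sub_integral_le {E : Type*} [NormedAddCommGroup E] [NormedSpace ℝ E]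
    {X : Type*} [MeasurableSpace X] [PseudoEMetricSpace X] [BorelSpace X]
    [SecondCountableTopology X] {ζ ν : Measure X} [IsProbabilityMeasure ζ]
    [IsProbabilityMeasure ν] {g : X → E} {K : ℝ≥0∞}
    (hg : ∀ x y, edist (g x) (g y) ≤ K * edist x y) (hζ : Integrable g ζ) (hν : Integrable g ν) :
    ‖∫ x, g x ∂ζ - ∫ x, g x ∂ν‖ₑ ≤ K * W ζ ν := by
  rcases eq_or_ne (W ζ ν) 0 with h0 | h0
  · simp [eq_of_W_eq_zero h0]
  rcases eq_or_ne K ⊤ with rfl | hK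
  · simp [ENNReal.top_mul h0]
  · lift K to ℝ≥0 using hK
    exact enorm_integral_sub_integral_le_of_lipschitzWith hg hζ hν

lemma W_triangle [StandardBorelSpace X] (ζ ν ξ : Measure X)
    [IsProbabilityMeasure ζ] [IsProbabilityMeasure ν] : W ζ ξ ≤ W ζ ν + W ν ξ := by
  suffices h : ∀ c d, IsCoupling c ζ ν → IsCoupling d ν ξ →
      W ζ ξ ≤ ∫⁻ p, edist p.1 p.2 ∂c + ∫⁻ p, edist p.1 p.2 ∂d from
    tsub_le_iff_right.1 <| le_W fun c hc => tsub_le_iff_right.2 <|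
      tsub_le_iff_left.1 <| le_W fun d hd => tsub_le_iff_left.2 (h c d hc hd)
  intro c d hc hd
  obtain ⟨e, rfl, rfl⟩ := exists_gluing hc hd
  have h12 : Measurable fun p : (X × X) × X => p.1 := measurable_fst
  have h23 : Measurable fun p : (X × X) × X => (p.1.2, p.2) := by fun_prop
  have h13 : Measurable fun p : (X × X) × X => (p.1.1, p.2) := by fun_prop
  have hcoupling : IsCoupling (e.map fun p => (p.1.1, p.2)) ζ ξ := by
    refine ⟨?_, ?_⟩
    · rw [← hc.map_fst, Measure.map_map measurable_fst h13, Measure.map_map measurable_fst h12]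
      rfl
    · rw [← hd.map_snd, Measure.map_map measurable_snd h13, Measure.map_map measurable_snd h23]
      rfl
  calc W ζ ξ ≤ ∫⁻ p, edist p.1 p.2 ∂(e.map fun p => (p.1.1, p.2)) :=
        W_le_lintegral_edist hcoupling
    _ = ∫⁻ p, edist p.1.1 p.2 ∂e := lintegral_map measurable_edist h13
    _ ≤ ∫⁻ p, (edist p.1.1 p.1.2 + edist p.1.2 p.2) ∂e :=
        lintegral_mono fun p => edist_triangle _ _ _
    _ = ∫⁻ p, edist p.1.1 p.1.2 ∂e + ∫⁻ p, edist p.1.2 p.2 ∂e :=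
        lintegral_add_left (by fun_prop) _
    _ = ∫⁻ p, edist p.1 p.2 ∂(e.map Prod.fst) +
          ∫⁻ p, edist p.1 p.2 ∂(e.map fun p => (p.1.2, p.2)) := by
        rw [lintegral_map measurable_edist h12, lintegral_map measurable_edist h23]

end Wasserstein

/-! ### Value functions and the performance difference identity -/

/-- The measurable functions that are uniformly bounded. Rewards, value functions and advantages
belong to this class, which is stable under integration against Markov kernels. -/
structure BoundedMeasurable {X : Type*} [MeasurableSpace X] (g : X → ℝ) : Prop where
  measurable : Measurable g
  exists_bound : ∃ b, ∀ x, ‖g x‖ ≤ b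

namespace BoundedMeasurable

variable {X Z : Type*} [MeasurableSpace X] [MeasurableSpace Z] {f g : X → ℝ}

lemma add (hf : BoundedMeasurable f) (hg : BoundedMeasurable g) :
    BoundedMeasurable fun x => f x + g x := by
  obtain ⟨hfm, a, ha⟩ := hf
  obtain ⟨hgm, b, hb⟩ := hg
  exact ⟨hfm.add hgm, a + b, fun x => norm_add_le_of_le (ha x) (hb x)⟩

lemma const_mul (hg : BoundedMeasurable g) (c : ℝ) : BoundedMeasurable fun x => c * g x := by
  obtain ⟨hgm, b, hb⟩ := hg
  refine ⟨hgm.const_mul c, ‖c‖ * b, fun x => ?_⟩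
  rw [norm_mul]
  exact mul_le_mul_of_nonneg_left (hb x) (norm_nonneg c)

lemma sub (hf : BoundedMeasurable f) (hg : BoundedMeasurable g) :
    BoundedMeasurable fun x => f x - g x := by
  simpa [sub_eq_add_neg] using hf.add (hg.const_mul (-1))

lemma comp_measurable (hg : BoundedMeasurable g) {φ : Z → X} (hφ : Measurable φ) :
    BoundedMeasurable fun z => g (φ z) :=
  ⟨hg.measurable.comp hφ, hg.exists_bound.imp fun _ hb z => hb (φ z)⟩

lemma integrable (hg : BoundedMeasurable g) (ν : Measure X) [IsFiniteMeasure ν] :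
    Integrable g ν :=
  let ⟨b, hb⟩ := hg.exists_bound
  .of_bound hg.measurable.aestronglyMeasurable b (.of_forall hb)

lemma exists_norm_integral_le (hg : BoundedMeasurable g) :
    ∃ b, ∀ ν : Measure X, IsProbabilityMeasure ν → ‖∫ x, g x ∂ν‖ ≤ b := by
  obtain ⟨b, hb⟩ := hg.exists_bound
  refine ⟨b, fun ν _ => ?_⟩
  simpa using norm_integral_le_of_norm_le_const (μ := ν) (.of_forall hb)

lemma integral_kernel_prod_right {f : X → Z → ℝ}
    (hf : BoundedMeasurable fun p : X × Z => f p.1 p.2) (κ : Kernel X Z) [IsMarkovKernel κ] :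
    BoundedMeasurable fun x => ∫ z, f x z ∂(κ x) := by
  obtain ⟨b, hb⟩ := hf.exists_bound
  refine ⟨(StronglyMeasurable.integral_kernel_prod_right (f := f)
    hf.measurable.stronglyMeasurable).measurable, b, fun x => ?_⟩
  simpa using norm_integral_le_of_norm_le_const (μ := κ x) (.of_forall fun z => hb (x, z))

lemma integral_kernel (hg : BoundedMeasurable g) (κ : Kernel Z X) [IsMarkovKernel κ] :
    BoundedMeasurable fun z => ∫ x, g x ∂(κ z) :=
  (hg.comp_measurable measurable_snd).integral_kernel_prod_right κ

lemma integral_bind (hg : BoundedMeasurable g) (ν : Measure Z) [IsProbabilityMeasure ν]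
    (κ : Kernel Z X) [IsMarkovKernel κ] :
    ∫ x, g x ∂(ν.bind κ) = ∫ z, ∫ x, g x ∂(κ z) ∂ν := by
  rw [Measure.comp_eq_comp_const_apply, Kernel.integral_comp (hg.integrable _),
    Kernel.const_apply]

lemma of_hasSum {F : ℕ → X → ℝ} {b : ℕ → ℝ} (hF : ∀ t, Measurable (F t)) (hb : Summable b)
    (hbound : ∀ t x, ‖F t x‖ ≤ b t) (hsum : ∀ x, HasSum (F · x) (g x)) : BoundedMeasurable g := by
  refine ⟨measurable_of_tendsto_metrizable (f := fun N x => ∑ t ∈ Finset.range N, F t x)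
    (fun N => Finset.measurable_sum _ fun t _ => hF t)
    (tendsto_pi_nhds.2 fun x => (hsum x).tendsto_sum_nat), ∑' t, b t, fun x => ?_⟩
  rw [← (hsum x).tsum_eq]
  exact tsum_of_norm_bounded hb.hasSum (hbound · x)

end BoundedMeasurable

namespace MDP

variable {X Y : Type*} [MeasurableSpace X] [MeasurableSpace Y] (M : MDP X Y)

instance : IsMarkovKernel M.P := M.markov

instance : IsProbabilityMeasure M.μ := M.prob

lemma exists_summable_bound {g : X → ℝ} (hg : BoundedMeasurable g) :
    ∃ b : ℕ → ℝ, Summable b ∧ ∀ t (ν : Measure X), IsProbabilityMeasure ν →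
      ‖M.γ ^ t * ∫ x, g x ∂ν‖ ≤ b t := by
  obtain ⟨b, hb⟩ := hg.exists_norm_integral_le
  refine ⟨fun t => M.γ ^ t * b,
    (summable_geometric_of_lt_one M.γ_nonneg M.γ_lt_one).mul_right b, fun t ν hν => ?_⟩
  rw [norm_mul, Real.norm_of_nonneg (pow_nonneg M.γ_nonneg t)]
  exact mul_le_mul_of_nonneg_left (hb ν hν) (pow_nonneg M.γ_nonneg t)

lemma summable_discounted {g : X → ℝ} (hg : BoundedMeasurable g) (ν : ℕ → Measure X)
    [∀ t, IsProbabilityMeasure (ν t)] : Summable fun t => M.γ ^ t * ∫ x, g x ∂(ν t) :=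
  let ⟨_, hb, hle⟩ := M.exists_summable_bound hg
  hb.of_norm_bounded fun t => hle t (ν t) inferInstance

variable (π : Kernel X Y)

/-- The one-step transition kernel of the state process under the policy `π`; `M.step π ν` is its
composition with `ν`. -/
noncomputable def trans : Kernel X X := M.P ∘ₖ (Kernel.id ×ₖ π)

/-- The `t`-step transition kernel of the state process under the policy `π`. -/
noncomputable def transN : ℕ → Kernel X X
  | 0 => Kernel.id
  | t + 1 => M.trans π ∘ₖ transN t

/-- The expected immediate reward under the policy `π`. -/
noncomputable def reward (s : X) : ℝ := ∫ a, M.R s a ∂(π s)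

lemma step_eq_bind (ν : Measure X) : M.step π ν = ν.bind (M.trans π) := rfl

lemma stepN_eq_bind (ν : Measure X) (t : ℕ) : M.stepN π ν t = ν.bind (M.transN π t) := by
  induction t with
  | zero => simp [stepN, transN, Measure.id_comp]
  | succ t ih => rw [stepN, transN, ih, step_eq_bind, Measure.comp_assoc]

lemma step_dirac (s : X) : M.step π (Measure.dirac s) = M.trans π s := by
  rw [step_eq_bind, Measure.dirac_bind (Kernel.measurable _)]

lemma stepN_dirac (s : X) (t : ℕ) : M.stepN π (Measure.dirac s) t = M.transN π t s := by
  rw [stepN_eq_bind, Measure.dirac_bind (Kernel.measurable _)]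

lemma stepN_step (ν : Measure X) (t : ℕ) : M.stepN π (M.step π ν) t = M.stepN π ν (t + 1) := by
  induction t with
  | zero => rfl
  | succ t ih => rw [stepN, ih]; rfl

variable [IsMarkovKernel π]

instance : IsMarkovKernel (M.trans π) := by unfold trans; infer_instance

instance (t : ℕ) : IsMarkovKernel (M.transN π t) := by
  induction t with
  | zero => unfold transN; infer_instance
  | succ t ih => unfold transN; infer_instance

instance (ν : Measure X) [IsProbabilityMeasure ν] : IsProbabilityMeasure (M.step π ν) := by
  rw [step_eq_bind]; infer_instance

instance (ν : Measure X) [IsProbabilityMeasure ν] (t : ℕ) :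
    IsProbabilityMeasure (M.stepN π ν t) := by
  rw [stepN_eq_bind]; infer_instance

lemma boundedMeasurable_R : BoundedMeasurable fun p : X × Y => M.R p.1 p.2 :=
  ⟨M.measurable_R, M.Rmax, fun p =>
    (Real.norm_of_nonneg (M.R_nonneg p.1 p.2)).trans_le (M.R_le p.1 p.2)⟩

lemma boundedMeasurable_reward : BoundedMeasurable (M.reward π) :=
  M.boundedMeasurable_R.integral_kernel_prod_right π

lemma hasSum_V (s : X) :
    HasSum (fun t => M.γ ^ t * ∫ s', M.reward π s' ∂(M.transN π t s)) (M.V π s) := by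
  simp only [V, stepN_dirac]
  exact (M.summable_discounted (M.boundedMeasurable_reward π) _).hasSum

lemma boundedMeasurable_V : BoundedMeasurable (M.V π) := by
  obtain ⟨b, hb, hle⟩ := M.exists_summable_bound (M.boundedMeasurable_reward π)
  exact .of_hasSum (fun t => (((M.boundedMeasurable_reward π).integral_kernel _).const_mul
    _).measurable) hb (fun t s => hle t (M.transN π t s) inferInstance) (M.hasSum_V π)

lemma boundedMeasurable_Q : BoundedMeasurable fun p : X × Y => M.Q π p.1 p.2 :=
  M.boundedMeasurable_R.add (((M.boundedMeasurable_V π).integral_kernel M.P).const_mul M.γ)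

lemma boundedMeasurable_Q_apply (s : X) : BoundedMeasurable (M.Q π s) :=
  (M.boundedMeasurable_Q π).comp_measurable measurable_prodMk_left

lemma hasSum_integral_V (ν : Measure X) [IsProbabilityMeasure ν] :
    HasSum (fun t => M.γ ^ t * ∫ s, M.reward π s ∂(M.stepN π ν t)) (∫ s, M.V π s ∂ν) := by
  have hr := M.boundedMeasurable_reward π
  obtain ⟨b, hb, hle⟩ := M.exists_summable_bound hr
  have hdom := hasSum_integral_of_dominated_convergence (μ := ν) (fun t _ => b t)
    (fun t => ((hr.integral_kernel (M.transN π t)).const_mul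
      (M.γ ^ t)).measurable.aestronglyMeasurable)
    (fun t => .of_forall fun s => hle t (M.transN π t s) inferInstance)
    (.of_forall fun _ => hb) (integrable_const _) (.of_forall (M.hasSum_V π))
  refine hdom.congr_fun fun t => ?_
  rw [integral_const_mul, stepN_eq_bind, hr.integral_bind]

lemma integral_V_eq (ν : Measure X) [IsProbabilityMeasure ν] :
    ∫ s, M.V π s ∂ν = ∫ s, M.reward π s ∂ν + M.γ * ∫ s, M.V π s ∂(M.step π ν) := by
  have hshift := (M.hasSum_integral_V π (M.step π ν)).mul_left M.γ
  simp_rw [stepN_step, ← mul_assoc, ← pow_succ'] at hshift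
  have hsum := HasSum.zero_add
    (f := fun t => M.γ ^ t * ∫ s, M.reward π s ∂(M.stepN π ν t)) hshift
  simpa [stepN] using (M.hasSum_integral_V π ν).unique hsum

theorem bellman (s : X) : M.V π s = M.reward π s + M.γ * ∫ s', M.V π s' ∂(M.trans π s) := by
  have h := M.integral_V_eq π (Measure.dirac s)
  rwa [integral_dirac' _ _ (M.boundedMeasurable_V π).measurable.stronglyMeasurable,
    integral_dirac' _ _ (M.boundedMeasurable_reward π).measurable.stronglyMeasurable,
    step_dirac] at h

variable (π' : Kernel X Y) [IsMarkovKernel π']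

lemma integral_trans {g : X → ℝ} (hg : BoundedMeasurable g) (s : X) :
    ∫ s', g s' ∂(M.trans π s) = ∫ a, ∫ s', g s' ∂(M.P (s, a)) ∂(π s) := by
  rw [trans, Kernel.integral_comp (hg.integrable _), Kernel.prod_apply, Kernel.id_apply,
    Measure.dirac_prod, integral_map measurable_prodMk_left.aemeasurable
      (hg.integral_kernel M.P).measurable.aestronglyMeasurable]

lemma integral_Q_eq (s : X) :
    ∫ a, M.Q π s a ∂(π' s) = M.reward π' s + M.γ * ∫ s', M.V π s' ∂(M.trans π' s) := by
  have hs : Measurable fun a : Y => (s, a) := measurable_prodMk_left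
  have hV := M.boundedMeasurable_V π
  rw [M.integral_trans π' hV, ← integral_const_mul]
  exact integral_add ((M.boundedMeasurable_R.comp_measurable hs).integrable _)
    ((((hV.integral_kernel M.P).const_mul M.γ).comp_measurable hs).integrable _)

lemma adv_eq_integral_Q_sub_V (s : X) : M.adv π s π' = ∫ a, M.Q π s a ∂(π' s) - M.V π s := by
  rw [adv, integral_sub ((M.boundedMeasurable_Q_apply π s).integrable _) (integrable_const _)]
  simp

lemma adv_eq_integral_Q_sub_integral_Q (s : X) :
    M.adv π s π' = ∫ a, M.Q π s a ∂(π' s) - ∫ a, M.Q π s a ∂(π s) := by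
  rw [adv_eq_integral_Q_sub_V, integral_Q_eq M π π, ← bellman]

lemma boundedMeasurable_adv : BoundedMeasurable fun s => M.adv π s π' := by
  simp_rw [adv_eq_integral_Q_sub_V]
  exact ((M.boundedMeasurable_Q π).integral_kernel_prod_right π').sub (M.boundedMeasurable_V π)

lemma integral_adv_eq (ν : Measure X) [IsProbabilityMeasure ν] :
    ∫ s, M.adv π s π' ∂ν = ∫ s, M.reward π' s ∂ν + M.γ * ∫ s, M.V π s ∂(M.step π' ν)
      - ∫ s, M.V π s ∂ν := by
  have hV := M.boundedMeasurable_V π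
  have hr := M.boundedMeasurable_reward π'
  have hPV := (hV.integral_kernel (M.trans π')).const_mul M.γ
  simp_rw [adv_eq_integral_Q_sub_V, integral_Q_eq]
  rw [integral_sub ((hr.add hPV).integrable ν) (hV.integrable ν),
    integral_add (hr.integrable ν) (hPV.integrable ν), integral_const_mul, step_eq_bind,
    hV.integral_bind]

-- The sum telescopes, since `∫ A^π(·, π') dν = ∫ r^π' dν + γ ∫ V^π dℙ(ν, π') - ∫ V^π dν`.
theorem hasSum_payoff_sub_payoff :
    HasSum (fun t => M.γ ^ t * ∫ s, M.adv π s π' ∂(M.stepN π' M.μ t))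
      (M.payoff π' - M.payoff π) := by
  set v : ℕ → ℝ := fun t => M.γ ^ t * ∫ s, M.V π s ∂(M.stepN π' M.μ t) with hv
  have hv_sum : Summable v := M.summable_discounted (M.boundedMeasurable_V π) _
  have htelescope : HasSum (fun t => v (t + 1) - v t) (-v 0) := by
    simpa using ((hasSum_nat_add_iff' 1).2 hv_sum.hasSum).sub hv_sum.hasSum
  have h := (M.hasSum_integral_V π' M.μ).add htelescope
  rw [← sub_eq_add_neg, show v 0 = M.payoff π by simp [hv, payoff, stepN]] at h
  refine h.congr_fun fun t => ?_
  rw [integral_adv_eq]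
  simp only [hv, stepN]
  ring

lemma hasSum_integral_visitation {g : X → ℝ} (hg : BoundedMeasurable g) (ν : Measure X)
    [IsProbabilityMeasure ν] :
    HasSum (fun t => M.γ ^ t * ∫ s, g s ∂(M.stepN π ν t))
      (1 / (1 - M.γ) * ∫ s, g s ∂(M.visitation π ν)) := by
  have hγ : 0 < 1 - M.γ := sub_pos.2 M.γ_lt_one
  have hterm (f : X → ℝ) (t : ℕ) : ∫ s, f s ∂(ENNReal.ofReal (M.γ ^ t) • M.stepN π ν t) =
      M.γ ^ t * ∫ s, f s ∂(M.stepN π ν t) := by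
    rw [integral_smul_measure, ENNReal.toReal_ofReal (pow_nonneg M.γ_nonneg t), smul_eq_mul]
  have hnorm : BoundedMeasurable fun s => ‖g s‖ :=
    ⟨hg.measurable.norm, hg.exists_bound.imp fun b hb s => by simpa using hb s⟩
  have hint : Integrable g (Measure.sum fun t => ENNReal.ofReal (M.γ ^ t) • M.stepN π ν t) := by
    refine integrable_sum_measure
      (fun t => (hg.integrable _).smul_measure ENNReal.ofReal_ne_top) ?_
    simp_rw [hterm]
    exact M.summable_discounted hnorm _
  rw [visitation, integral_smul_measure, ENNReal.toReal_ofReal hγ.le, smul_eq_mul, ← mul_assoc,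
    one_div, inv_mul_cancel₀ hγ.ne', one_mul]
  exact (hasSum_integral_measure hint).congr_fun fun t => (hterm g t).symm

theorem enorm_payoff_sub_le [PseudoEMetricSpace X] [BorelSpace X] [SecondCountableTopology X]
    {F : ℝ≥0∞} (hF : ∀ s s', edist (M.adv π s π') (M.adv π s' π') ≤ F * edist s s') :
    ‖M.payoff π' - (M.payoff π + 1 / (1 - M.γ) * ∫ s, M.adv π s π' ∂(M.visitation π M.μ))‖ₑ ≤
      F * ∑' t, ENNReal.ofReal (M.γ ^ t) * W (M.stepN π' M.μ t) (M.stepN π M.μ t) := by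
  have hA := M.boundedMeasurable_adv π π'
  have hsum := (M.hasSum_payoff_sub_payoff π π').sub (M.hasSum_integral_visitation π hA M.μ)
  rw [← sub_sub, ← hsum.tsum_eq, ← ENNReal.tsum_mul_left]
  refine enorm_tsum_le_tsum_enorm.trans (ENNReal.tsum_le_tsum fun t => ?_)
  rw [← mul_sub, enorm_mul, Real.enorm_of_nonneg (pow_nonneg M.γ_nonneg t), mul_left_comm]
  gcongr
  exact enorm_integral_sub_integral_le hF (hA.integrable _) (hA.integrable _)

end MDP

/-! ### Upper slopes and Lipschitz bounds -/

section UpperSlope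

variable {E F : Type*} [NormedAddCommGroup E] [NormedSpace ℝ E] [NormedAddCommGroup F]

/-- The upper slope of `f` at `x` in the direction `v`: the upper limit of the absolute difference
quotients. It replaces the absolute value of a directional derivative for functions that are not
known to be differentiable, and is the notion of partial derivative used in `mixPartial`. -/
noncomputable def upperSlope (f : E → F) (x v : E) : ℝ≥0∞ :=
  limsup (fun t : ℝ => ‖f (x + t • v) - f x‖ₑ / ‖t‖ₑ) (𝓝[≠] 0)

variable {f g : E → F} {x v : E} {s : Set E}

lemma tendsto_add_smul_nhdsNE (x v : E) : Tendsto (fun t : ℝ => x + t • v) (𝓝[≠] 0) (𝓝 x) := by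
  have h : Continuous fun t : ℝ => x + t • v := by fun_prop
  simpa using (h.tendsto 0).mono_left nhdsWithin_le_nhds

lemma upperSlope_congr (h : f =ᶠ[𝓝 x] g) : upperSlope f x v = upperSlope g x v := by
  refine limsup_congr ?_
  filter_upwards [(tendsto_add_smul_nhdsNE x v).eventually h] with t ht
  rw [ht, h.eq_of_nhds]

lemma upperSlope_smul (c : ℝ) : upperSlope f x (c • v) = ‖c‖ₑ * upperSlope f x v := by
  rcases eq_or_ne c 0 with rfl | hc
  · simp [upperSlope]
  have hc0 : ‖c‖ₑ ≠ 0 := by simpa using hc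
  have hmap : map (fun t : ℝ => t * c) (𝓝[≠] 0) = 𝓝[≠] 0 := by
    simpa using (Homeomorph.mulRight₀ c hc).map_punctured_nhds_eq 0
  rw [upperSlope, upperSlope, ← ENNReal.limsup_const_mul_of_ne_top enorm_ne_top]
  conv_rhs => rw [← hmap]
  rw [limsup, limsup, map_map]
  congr 2
  ext t
  rw [Function.comp_apply, smul_smul, enorm_mul, mul_comm ‖t‖ₑ, ← mul_div_assoc,
    ENNReal.mul_div_mul_left _ _ hc0 enorm_ne_top]

lemma upperSlope_le_of_lipschitzOnWith {K : ℝ≥0} (hf : LipschitzOnWith K f s) (hs : s ∈ 𝓝 x) :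
    upperSlope f x v ≤ K * ‖v‖ₑ := by
  refine limsup_le_of_le (by isBoundedDefault) ?_
  filter_upwards [(tendsto_add_smul_nhdsNE x v).eventually hs] with t ht
  refine ENNReal.div_le_of_le_mul ?_
  rw [← edist_eq_enorm_sub, mul_assoc, mul_comm ‖v‖ₑ, ← enorm_smul]
  simpa [edist_eq_enorm_sub] using hf ht (mem_of_mem_nhds hs)

lemma upperSlope_eq_enorm_of_hasLineDerivAt [NormedSpace ℝ F] {f' : F}
    (h : HasLineDerivAt ℝ f f' x v) : upperSlope f x v = ‖f'‖ₑ := by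
  refine Tendsto.limsup_eq (((continuous_enorm.tendsto f').comp
    (hasLineDerivAt_iff_tendsto_slope_zero.1 h)).congr' ?_)
  filter_upwards [self_mem_nhdsWithin] with t ht
  rw [Function.comp_apply, enorm_smul, enorm_inv ht, ENNReal.div_eq_inv_mul]

lemma eventually_norm_sub_le_of_upperSlope_lt {r : ℝ≥0} (h : upperSlope f x v < r) :
    ∀ᶠ t : ℝ in 𝓝 0, ‖f (x + t • v) - f x‖ ≤ r * |t| := by
  have h' := eventually_nhdsWithin_iff.1 (eventually_lt_of_limsup_lt h)
  filter_upwards [h'] with t ht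
  rcases eq_or_ne t 0 with rfl | ht0
  · simp
  · have := (ENNReal.div_le_iff (by simpa) enorm_ne_top).1 (ht ht0).le
    rw [enorm_eq_nnnorm, enorm_eq_nnnorm] at this
    exact_mod_cast this

lemma enorm_sub_le_of_upperSlope_le {C : ℝ≥0}
    (h : ∀ t ∈ Set.Icc (0 : ℝ) 1, upperSlope f (x + t • v) v ≤ C) :
    ‖f (x + v) - f x‖ₑ ≤ C := by
  have hloc (t : ℝ) (ht : t ∈ Set.Icc (0 : ℝ) 1) (r : ℝ≥0) (hr : C < r) :
      ∀ᶠ u in 𝓝 t, ‖f (x + u • v) - f (x + t • v)‖ ≤ r * |u - t| := by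
    have hsub : Tendsto (fun u : ℝ => u - t) (𝓝 t) (𝓝 0) := by
      simpa using (continuous_sub_right t).tendsto t
    filter_upwards [hsub.eventually (eventually_norm_sub_le_of_upperSlope_lt
      ((h t ht).trans_lt (by exact_mod_cast hr)))] with u hu
    simpa [add_assoc, ← add_smul] using hu
  have hcont : ContinuousOn (fun t : ℝ => f (x + t • v)) (Set.Icc 0 1) := by
    refine continuousOn_of_forall_continuousAt fun t ht => ?_
    rw [ContinuousAt, tendsto_iff_norm_sub_tendsto_zero]
    have hlim : Tendsto (fun u : ℝ => ((C + 1 : ℝ≥0) : ℝ) * |u - t|) (𝓝 t) (𝓝 0) :=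
      Continuous.tendsto' (by fun_prop) _ _ (by simp)
    exact squeeze_zero' (.of_forall fun _ => norm_nonneg _) (hloc t ht _ (lt_add_one C)) hlim
  have hbound := image_le_of_liminf_slope_right_le_deriv_boundary (a := 0) (b := 1)
    (f := fun t : ℝ => ‖f (x + t • v) - f x‖) (B := fun t => C * t) (B' := fun _ => C)
    (hcont.sub continuousOn_const).norm (by simp) (by fun_prop)
    (fun t _ => by simpa using ((hasDerivAt_id t).const_mul (C : ℝ)).hasDerivWithinAt) ?_
    (Set.right_mem_Icc.2 zero_le_one)
  · rw [← ofReal_norm]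
    exact ENNReal.ofReal_le_of_le_toReal (by simpa using hbound)
  intro t ht r hr
  obtain ⟨q, hCq, hqr⟩ := exists_between hr
  lift q to ℝ≥0 using C.2.trans hCq.le
  refine Eventually.frequently ?_
  filter_upwards [nhdsWithin_le_nhds (hloc t ⟨ht.1, ht.2.le⟩ q (by exact_mod_cast hCq)),
    self_mem_nhdsWithin] with u hu htu
  have htu' : 0 < u - t := sub_pos.2 htu
  rw [slope_def_field, div_lt_iff₀ htu']
  rw [abs_of_pos htu'] at hu
  have := norm_sub_norm_le (f (x + u • v) - f x) (f (x + t • v) - f x)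
  rw [sub_sub_sub_cancel_right] at this
  nlinarith

lemma lipschitzOnWith_of_upperSlope_le {C : ℝ≥0} (hs : Convex ℝ s)
    (h : ∀ x ∈ s, ∀ v, upperSlope f x v ≤ C * ‖v‖ₑ) : LipschitzOnWith C f s := by
  intro y hy x hx
  have hseg := enorm_sub_le_of_upperSlope_le (f := f) (x := x) (v := y - x) (C := C * ‖y - x‖₊)
    fun t ht => by
      simpa [enorm_eq_nnnorm] using h _ (hs.add_smul_sub_mem hx hy ht) (y - x)
  simpa [edist_eq_enorm_sub, enorm_eq_nnnorm] using hseg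

end UpperSlope

section CoordinateSlopes

variable {E : Type*} [NormedAddCommGroup E] [InnerProductSpace ℝ E] {ι : Type*}

lemma norm_sum_inner_smul_le {e : ι → E} (he : Orthonormal ℝ e) (J : Finset ι) (v : E) :
    ‖∑ j ∈ J, inner ℝ (e j) v • e j‖ ≤ ‖v‖ := by
  refine le_of_sq_le_sq ?_ (norm_nonneg v)
  rw [← real_inner_self_eq_norm_sq, he.inner_sum]
  simpa [← sq] using he.sum_inner_products_le v (s := J)

lemma enorm_add_sum_smul_sub_le {V F : Type*} [NormedAddCommGroup V] [NormedSpace ℝ V]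
    [NormedAddCommGroup F] {f : V → F} {s : Set V} (hs : Convex ℝ s) {e : ι → V} {C : ℝ≥0}
    (hf : ∀ y ∈ s, ∀ j, upperSlope f y (e j) ≤ C) {y : V} (c : ι → ℝ) (J : Finset ι)
    (hmem : ∀ I ⊆ J, y + ∑ j ∈ I, c j • e j ∈ s) :
    ‖f (y + ∑ j ∈ J, c j • e j) - f y‖ₑ ≤ C * ∑ j ∈ J, ‖c j‖ₑ := by
  classical
  induction J using Finset.induction_on with
  | empty => simp
  | insert i J hi ih =>
    specialize ih fun I hI => hmem I (hI.trans (Finset.subset_insert i J))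
    have hzs := hmem J (Finset.subset_insert i J)
    have hzis := hmem _ subset_rfl
    rw [Finset.sum_insert hi, add_left_comm, add_comm] at hzis ⊢
    set z := y + ∑ j ∈ J, c j • e j
    have hlast : ‖f (z + c i • e i) - f z‖ₑ ≤ C * ‖c i‖ₑ := by
      refine enorm_sub_le_of_upperSlope_le (C := C * ‖c i‖₊) fun t ht => ?_
      rw [upperSlope_smul, mul_comm, ENNReal.coe_mul, ← enorm_eq_nnnorm]
      gcongr
      exact hf _ (hs.add_smul_mem hzs hzis ht) i
    calc ‖f (z + c i • e i) - f y‖ₑ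
        ≤ ‖f (z + c i • e i) - f z‖ₑ + ‖f z - f y‖ₑ := by
          rw [← sub_add_sub_cancel _ (f z)]; exact enorm_add_le _ _
      _ ≤ C * ‖c i‖ₑ + C * ∑ j ∈ J, ‖c j‖ₑ := add_le_add hlast ih
      _ = C * ∑ j ∈ insert i J, ‖c j‖ₑ := by rw [Finset.sum_insert hi, mul_add]

variable [Fintype ι]

lemma exists_lipschitzOnWith_ball_of_upperSlope_le {F : Type*} [NormedAddCommGroup F]
    (b : OrthonormalBasis ι ℝ E) {f : E → F} {x : E} {r : ℝ} {C : ℝ≥0}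
    (hf : ∀ y ∈ Metric.ball x r, ∀ j, upperSlope f y (b j) ≤ C) :
    ∃ K : ℝ≥0, LipschitzOnWith K f (Metric.ball x (r / 3)) := by
  refine ⟨C * Fintype.card ι, fun z hz y hy => ?_⟩
  have hmem (J : Finset ι) : y + ∑ j ∈ J, inner ℝ (b j) (z - y) • b j ∈ Metric.ball x r := by
    rw [mem_ball_iff_norm] at hy hz ⊢
    have := norm_add_le (y - x) (∑ j ∈ J, inner ℝ (b j) (z - y) • b j)
    have := norm_sum_inner_smul_le b.orthonormal J (z - y)
    have := norm_sub_le_norm_sub_add_norm_sub z x y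
    rw [norm_sub_rev x y] at this
    rw [add_sub_right_comm]
    linarith
  have h := enorm_add_sum_smul_sub_le (convex_ball x r) hf (fun j => inner ℝ (b j) (z - y))
    Finset.univ fun J _ => hmem J
  rw [b.sum_repr' (z - y), add_sub_cancel] at h
  have hcoord (j : ι) : ‖inner ℝ (b j) (z - y)‖ₑ ≤ edist z y := by
    rw [edist_eq_enorm_sub, enorm_le_iff_norm_le]
    simpa using norm_inner_le_norm (𝕜 := ℝ) (b j) (z - y)
  calc edist (f z) (f y) ≤ C * ∑ j, ‖inner ℝ (b j) (z - y)‖ₑ := by rwa [edist_eq_enorm_sub]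
    _ ≤ C * ∑ _j : ι, edist z y := by gcongr with j; exact hcoord j
    _ = (C * Fintype.card ι : ℝ≥0) * edist z y := by simp [mul_assoc]

lemma enorm_sq_eq_sum_enorm_sq_apply (b : OrthonormalBasis ι ℝ E) (l : StrongDual ℝ E) :
    ‖l‖ₑ ^ 2 = ∑ j, ‖l (b j)‖ₑ ^ 2 := by
  have := b.toBasis.finiteDimensional_of_finite
  have := FiniteDimensional.complete ℝ E
  have hsq : ‖l‖₊ ^ 2 = ∑ j, ‖l (b j)‖₊ ^ 2 := by
    apply NNReal.eq
    push_cast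
    rw [← (InnerProductSpace.toDual ℝ E).symm.norm_map l, ← b.sum_sq_norm_inner_left]
    simp
  simp only [enorm_eq_nnnorm]
  exact_mod_cast hsq

end CoordinateSlopes

section Rademacher

variable {E : Type*} [NormedAddCommGroup E] [NormedSpace ℝ E] [FiniteDimensional ℝ E]
  [MeasurableSpace E] [BorelSpace E]

lemma norm_sub_le_of_norm_deriv_le_ae {g : ℝ → ℝ} {K : ℝ≥0} (hg : LipschitzWith K g) {C a b : ℝ}
    (h : ∀ᵐ t, t ∈ Set.uIoc a b → ‖deriv g t‖ ≤ C) : ‖g b - g a‖ ≤ C * |b - a| := by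
  rw [← hg.lipschitzOnWith.absolutelyContinuousOnInterval.integral_deriv_eq_sub]
  exact intervalIntegral.norm_integral_le_of_norm_le_const_ae h

variable {μ : Measure E} [μ.IsAddHaarMeasure] {f : E → ℝ}

lemma ae_ae_differentiableAt_norm_fderiv_le {K : ℝ≥0} (hf : LipschitzWith K f) {s : Set E}
    (hs : MeasurableSet s) {C : ℝ} (h : ∀ᵐ y ∂μ, y ∈ s → ‖fderiv ℝ f y‖ ≤ C) (v : E) :
    ∀ᵐ z ∂μ, ∀ᵐ t : ℝ, DifferentiableAt ℝ f (z + t • v) ∧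
      (z + t • v ∈ s → ‖fderiv ℝ f (z + t • v)‖ ≤ C) := by
  have hmeas : MeasurableSet {y | DifferentiableAt ℝ f y ∧ (y ∈ s → ‖fderiv ℝ f y‖ ≤ C)} :=
    (measurableSet_of_differentiableAt ℝ f).inter
      (hs.imp (measurableSet_le (measurable_fderiv ℝ f).norm measurable_const))
  exact (ae_ae_add_linearMap_mem_iff (LinearMap.toSpanSingleton ℝ E v) volume μ hmeas).2
    (hf.ae_differentiableAt.and h)

lemma lipschitzOnWith_of_ae_norm_fderiv_le {K C : ℝ≥0} (hf : LipschitzWith K f) {U : Set E}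
    (hU : IsOpen U) (hconv : Convex ℝ U) (h : ∀ᵐ y ∂μ, y ∈ U → ‖fderiv ℝ f y‖ ≤ C) :
    LipschitzOnWith C f U := by
  have hcont := hf.continuous
  refine LipschitzOnWith.of_dist_le_mul fun y hy x hx => ?_
  set v := y - x
  -- By Fubini, the fundamental theorem of calculus applies on the translate by almost every `z`.
  have hae : ∀ᵐ z ∂μ, z ∈ U → z + v ∈ U → ‖f (z + v) - f z‖ ≤ C * ‖v‖ := by
    filter_upwards [ae_ae_differentiableAt_norm_fderiv_le hf hU.measurableSet h v] with z hz h0 h1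
    have hline : LipschitzWith (K * ‖v‖₊) fun t : ℝ => f (z + t • v) :=
      hf.comp <| LipschitzWith.of_dist_le_mul fun t u => by
        simp [dist_eq_norm, ← sub_smul, norm_smul, mul_comm]
    have hderiv : ∀ᵐ t : ℝ, t ∈ Set.uIoc 0 1 →
        ‖deriv (fun t : ℝ => f (z + t • v)) t‖ ≤ C * ‖v‖ := by
      filter_upwards [hz] with t ⟨hdiff, hbound⟩ ht
      rw [Set.uIoc_of_le zero_le_one] at ht
      have hlin : HasDerivAt (fun t : ℝ => z + t • v) v t := by
        simpa using ((hasDerivAt_id t).smul_const v).const_add z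
      have hcomp : deriv (fun t : ℝ => f (z + t • v)) t = fderiv ℝ f (z + t • v) v :=
        (hdiff.hasFDerivAt.comp_hasDerivAt t hlin).deriv
      rw [hcomp]
      exact ContinuousLinearMap.le_of_opNorm_le _
        (hbound (hconv.add_smul_mem h0 h1 ⟨ht.1.le, ht.2⟩)) v
    simpa using norm_sub_le_of_norm_deriv_le_ae hline hderiv
  have hclosed : IsClosed {z | ‖f (z + v) - f z‖ ≤ C * ‖v‖} :=
    isClosed_le (by fun_prop) (by fun_prop)
  have hopen : IsOpen (U ∩ (· + v) ⁻¹' U) := hU.inter (hU.preimage (by fun_prop))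
  have hxmem := (Measure.dense_of_ae hae).open_subset_closure_inter hopen
    ⟨hx, by simpa [v] using hy⟩
  have hsub : (U ∩ (· + v) ⁻¹' U) ∩ {z | z ∈ U → z + v ∈ U → ‖f (z + v) - f z‖ ≤ C * ‖v‖} ⊆
      {z | ‖f (z + v) - f z‖ ≤ C * ‖v‖} := fun z hz => hz.2 hz.1.1 hz.1.2
  simpa [v, dist_eq_norm] using hclosed.closure_subset_iff.2 hsub hxmem

end Rademacher

section GradientBound

variable {E : Type*} [NormedAddCommGroup E] [InnerProductSpace ℝ E] {ι : Type*} [Fintype ι]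
  {f : E → ℝ} {U : Set E}

lemma enorm_fderiv_le_of_sum_upperSlope_sq_le (b : OrthonormalBasis ι ℝ E)
    {x : E} (hf : DifferentiableAt ℝ f x) {C : ℝ≥0∞}
    (h : ∑ j, upperSlope f x (b j) ^ 2 ≤ C ^ 2) : ‖fderiv ℝ f x‖ₑ ≤ C := by
  rw [← ENNReal.pow_le_pow_left_iff two_ne_zero]
  refine (enorm_sq_eq_sum_enorm_sq_apply b _).trans_le (le_of_eq_of_le ?_ h)
  exact Finset.sum_congr rfl fun j _ => by
    rw [upperSlope_eq_enorm_of_hasLineDerivAt (hf.hasFDerivAt.hasLineDerivAt (b j))]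

/-- A bound on the upper slopes along the coordinate axes yields local Lipschitz continuity, hence
differentiability almost everywhere, where the slopes are the components of the gradient. -/
theorem lipschitzOnWith_of_sum_upperSlope_sq_le (b : OrthonormalBasis ι ℝ E) (hU : IsOpen U)
    (hconv : Convex ℝ U) {C : ℝ≥0} (h : ∀ x ∈ U, ∑ j, upperSlope f x (b j) ^ 2 ≤ C ^ 2) :
    LipschitzOnWith C f U := by
  have := b.toBasis.finiteDimensional_of_finite
  borelize E
  have hcoord (x : E) (hx : x ∈ U) (j : ι) : upperSlope f x (b j) ≤ C := by
    rw [← ENNReal.pow_le_pow_left_iff two_ne_zero]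
    exact (Finset.single_le_sum (f := fun j => upperSlope f x (b j) ^ 2)
      (fun _ _ => zero_le) (Finset.mem_univ j)).trans (h x hx)
  refine lipschitzOnWith_of_upperSlope_le hconv fun x hx v => ?_
  obtain ⟨r, hr, hball⟩ := Metric.isOpen_iff.1 hU x hx
  obtain ⟨K, hK⟩ := exists_lipschitzOnWith_ball_of_upperSlope_le b fun y hy => hcoord y (hball hy)
  have hsub : Metric.ball x (r / 3) ⊆ U := (Metric.ball_subset_ball (by linarith)).trans hball
  obtain ⟨g, hg, hfg⟩ := hK.extend_real
  have hgrad (y : E) (hgy : DifferentiableAt ℝ g y) (hy : y ∈ Metric.ball x (r / 3)) :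
      ‖fderiv ℝ g y‖ ≤ C := by
    have heq : f =ᶠ[𝓝 y] g := hfg.eventuallyEq_of_mem (Metric.isOpen_ball.mem_nhds hy)
    have := enorm_fderiv_le_of_sum_upperSlope_sq_le b hgy (C := C) <| by
      simpa only [upperSlope_congr heq] using h y (hsub hy)
    rw [enorm_eq_nnnorm] at this
    exact_mod_cast this
  have hlip : LipschitzOnWith C g (Metric.ball x (r / 3)) :=
    lipschitzOnWith_of_ae_norm_fderiv_le (μ := volume) hg Metric.isOpen_ball (convex_ball x _)
      (hg.ae_differentiableAt.mono hgrad)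
  have hnhds : Metric.ball x (r / 3) ∈ 𝓝 x := Metric.ball_mem_nhds x (by positivity)
  rw [upperSlope_congr (hfg.eventuallyEq_of_mem hnhds)]
  exact upperSlope_le_of_lipschitzOnWith hlip hnhds

end GradientBound

/-! ### The Lipschitz constant of the advantage -/

lemma zeroExt_of_mem {E : Type*} {D : Set E} (f : D → ℝ) {x : E} (h : x ∈ D) :
    zeroExt D f x = f ⟨x, h⟩ :=
  dif_pos h

lemma zeroExt_coe {E : Type*} {D : Set E} (f : D → ℝ) (x : D) : zeroExt D f x = f x :=
  zeroExt_of_mem f x.2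

lemma DiffOn.edist_le {d : ℕ} {D : Set (EuclideanSpace ℝ (Fin d))} {f : D → ℝ} (hf : DiffOn D f)
    (hD : Convex ℝ D) (x y : D) : edist (f x) (f y) ≤ Lip D f * edist x y := by
  rcases eq_or_ne x y with rfl | hxy
  · simp
  rcases eq_or_ne (Lip D f) ⊤ with htop | hfin
  · simp [htop, hxy]
  lift Lip D f to ℝ≥0 using hfin with K hK
  have h := hD.lipschitzOnWith_of_nnnorm_fderivWithin_le hf (C := K) fun z hz => by
    have := le_iSup (fun x : D => ‖fderivWithin ℝ (zeroExt D f) D x‖ₑ) ⟨z, hz⟩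
    rw [← Lip, ← hK] at this
    simpa using this
  simpa only [zeroExt_coe, Subtype.edist_eq] using h x.2 y.2

section IntegralDerivative

variable {X : Type*} [MeasurableSpace X] [PseudoMetricSpace X] [OpensMeasurableSpace X]
  [SecondCountableTopology X] {ζ ν : Measure X} {K : ℝ≥0}

lemma hasDerivAt_integral_sub_integral {q q' : ℝ → X → ℝ} {t₀ : ℝ} {c : Measure (X × X)}
    (hc : IsCoupling c ζ ν) (hcost : K * ∫⁻ p, edist p.1 p.2 ∂c ≠ ⊤)
    (hq : ∀ᶠ t in 𝓝 t₀, ∀ a, HasDerivAt (q · a) (q' t a) t)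
    (hq' : ∀ᶠ t in 𝓝 t₀, LipschitzWith K (q' t))
    (hint : ∀ᶠ t in 𝓝 t₀, Integrable (q t) ζ ∧ Integrable (q t) ν) :
    HasDerivAt (fun t => ∫ a, q t a ∂ζ - ∫ a, q t a ∂ν)
      (∫ p, (q' t₀ p.1 - q' t₀ p.2) ∂c) t₀ := by
  have hpair : ∀ᶠ t in 𝓝 t₀, Integrable (fun p : X × X => q t p.1 - q t p.2) c :=
    hint.mono fun t ht => (hc.integrable_fst ht.1).sub (hc.integrable_snd ht.2)
  have hmeas : Measurable (q' t₀) := hq'.self_of_nhds.continuous.measurable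
  have hbound : Integrable (fun p : X × X => (K * edist p.1 p.2).toReal) c :=
    integrable_toReal_of_lintegral_ne_top (by fun_prop)
      (by rwa [lintegral_const_mul _ measurable_edist])
  have hcoupled := (hasDerivAt_integral_of_dominated_loc_of_deriv_le
    (F := fun t (p : X × X) => q t p.1 - q t p.2) (F' := fun t p => q' t p.1 - q' t p.2)
    (hq.and hq') (hpair.mono fun t ht => ht.aestronglyMeasurable) hpair.self_of_nhds
    (by fun_prop) (.of_forall fun p t ht => ?_) hbound
    (.of_forall fun p t ht => (ht.1 p.1).sub (ht.1 p.2))).2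
  · refine hcoupled.congr_of_eventuallyEq (hint.mono fun t ht => ?_)
    exact hc.integral_sub_integral ht.1 ht.2
  · rw [ENNReal.toReal_mul, ENNReal.coe_toReal, ← dist_edist, ← dist_eq_norm]
    exact ht.2.dist_le_mul p.1 p.2

-- The uniform constant `K` serves only to differentiate under the integral sign; the bound is in
-- terms of the Lipschitz constant `Λ` at the point.
lemma upperSlope_integral_sub_integral_le [IsProbabilityMeasure ζ] [IsProbabilityMeasure ν]
    {E : Type*} [NormedAddCommGroup E] [NormedSpace ℝ E]
    {q q' : E → X → ℝ} {x v : E} {Λ : ℝ≥0∞} (hΛ : Λ ≠ ⊤) (hK : K * W ζ ν ≠ ⊤)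
    (hq : ∀ᶠ y in 𝓝 x, ∀ a, HasLineDerivAt ℝ (q · a) (q' y a) y v)
    (hq' : ∀ᶠ y in 𝓝 x, LipschitzWith K (q' y))
    (hx : ∀ a b, edist (q' x a) (q' x b) ≤ Λ * edist a b)
    (hint : ∀ᶠ y in 𝓝 x, Integrable (q y) ζ ∧ Integrable (q y) ν) :
    upperSlope (fun y => ∫ a, q y a ∂ζ - ∫ a, q y a ∂ν) x v ≤ Λ * W ζ ν := by
  refine le_mul_W hΛ hK fun c hc hcost => ?_
  have hline : Tendsto (fun t : ℝ => x + t • v) (𝓝 0) (𝓝 x) :=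
    Continuous.tendsto' (by fun_prop) _ _ (by simp)
  have hderiv : HasLineDerivAt ℝ (fun y => ∫ a, q y a ∂ζ - ∫ a, q y a ∂ν)
      (∫ p, (q' x p.1 - q' x p.2) ∂c) x v := by
    have := hasDerivAt_integral_sub_integral (t₀ := 0) (q := fun t => q (x + t • v))
      (q' := fun t => q' (x + t • v)) hc hcost ((hline.eventually hq).mono fun t ht a => ?_)
      (hline.eventually hq') (hline.eventually hint)
    · simpa [HasLineDerivAt] using this
    · have hshift : HasDerivAt (fun u => q (x + t • v + u • v) a) (q' (x + t • v) a) (t - t) := by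
        rw [sub_self]
        exact ht a
      refine (hshift.comp_sub_const t t).congr_of_eventuallyEq (.of_forall fun u => ?_)
      simp only [add_assoc, ← add_smul, add_sub_cancel]
  rw [upperSlope_eq_enorm_of_hasLineDerivAt hderiv]
  calc ‖∫ p, (q' x p.1 - q' x p.2) ∂c‖ₑ
      ≤ ∫⁻ p, ‖q' x p.1 - q' x p.2‖ₑ ∂c := enorm_integral_le_lintegral_enorm _
    _ ≤ ∫⁻ p, Λ * edist p.1 p.2 ∂c :=
      lintegral_mono fun p => by simpa [edist_eq_enorm_sub] using hx p.1 p.2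
    _ = Λ * ∫⁻ p, edist p.1 p.2 ∂c := lintegral_const_mul _ measurable_edist

end IntegralDerivative

lemma enorm_integral_sub_integral_sub_le {X : Type*} [MeasurableSpace X] [PseudoEMetricSpace X]
    [BorelSpace X] [SecondCountableTopology X] {ζ ν ζ' ν' : Measure X} [IsProbabilityMeasure ζ]
    [IsProbabilityMeasure ν] [IsProbabilityMeasure ζ'] [IsProbabilityMeasure ν'] {g : X → ℝ}
    {K : ℝ≥0∞} (hg : ∀ x y, edist (g x) (g y) ≤ K * edist x y) (hζ : Integrable g ζ)
    (hν : Integrable g ν) (hζ' : Integrable g ζ') (hν' : Integrable g ν') :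
    ‖(∫ x, g x ∂ζ' - ∫ x, g x ∂ν') - (∫ x, g x ∂ζ - ∫ x, g x ∂ν)‖ₑ ≤
      2 * K * W ((2⁻¹ : ℝ≥0∞) • (ζ' + ν)) ((2⁻¹ : ℝ≥0∞) • (ζ + ν')) := by
  have isProb (α β : Measure X) [IsProbabilityMeasure α] [IsProbabilityMeasure β] :
      IsProbabilityMeasure ((2⁻¹ : ℝ≥0∞) • (α + β)) :=
    ⟨by simp [ENNReal.inv_two_add_inv_two]⟩
  have integrable_mix {α β : Measure X} (hα : Integrable g α) (hβ : Integrable g β) :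
      Integrable g ((2⁻¹ : ℝ≥0∞) • (α + β)) := (hα.add_measure hβ).smul_measure (by simp)
  have integral_mix {α β : Measure X} (hα : Integrable g α) (hβ : Integrable g β) :
      ∫ x, g x ∂((2⁻¹ : ℝ≥0∞) • (α + β)) = 2⁻¹ * (∫ x, g x ∂α + ∫ x, g x ∂β) := by
    rw [integral_smul_measure, integral_add_measure hα hβ]
    simp
  have heq : (∫ x, g x ∂ζ' - ∫ x, g x ∂ν') - (∫ x, g x ∂ζ - ∫ x, g x ∂ν) =
      2 * (∫ x, g x ∂((2⁻¹ : ℝ≥0∞) • (ζ' + ν)) - ∫ x, g x ∂((2⁻¹ : ℝ≥0∞) • (ζ + ν'))) := by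
    rw [integral_mix hζ' hν, integral_mix hζ hν']
    ring
  rw [heq, enorm_mul, mul_assoc]
  gcongr
  · simp [Real.enorm_eq_ofReal]
  · exact enorm_integral_sub_integral_le hg (integrable_mix hζ' hν) (integrable_mix hζ hν')

lemma limsup_add_le_limsup_add_limsup {ι : Type*} {f : Filter ι} (u v : ι → ℝ≥0∞) :
    limsup (fun i => u i + v i) f ≤ limsup u f + limsup v f := by
  refine ENNReal.le_of_forall_pos_le_add fun ε hε hfin => ?_
  have hε2 : ((ε / 2 : ℝ≥0) : ℝ≥0∞) ≠ 0 := by simpa using hε.ne'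
  obtain ⟨hu, hv⟩ := ENNReal.add_lt_top.1 hfin
  refine limsup_le_of_le (by isBoundedDefault) ?_
  filter_upwards [eventually_lt_of_limsup_lt (ENNReal.lt_add_right hu.ne hε2),
    eventually_lt_of_limsup_lt (ENNReal.lt_add_right hv.ne hε2)] with i hui hvi
  calc u i + v i ≤ (limsup u f + (ε / 2 : ℝ≥0)) + (limsup v f + (ε / 2 : ℝ≥0)) :=
        add_le_add hui.le hvi.le
    _ = limsup u f + limsup v f + ε := by
      rw [add_add_add_comm, ← ENNReal.coe_add, add_halves]

lemma sum_mul_add_mul_sq_rpow_le {ι : Type*} [Fintype ι] (u v : ι → ℝ≥0∞) (c w : ℝ≥0∞) :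
    (∑ j, (c * u j + v j * w) ^ 2) ^ (1 / 2 : ℝ) ≤
      c * (∑ j, u j ^ 2) ^ (1 / 2 : ℝ) + (∑ j, v j ^ 2) ^ (1 / 2 : ℝ) * w := by
  have rpow_sum_mul_sq (a : ι → ℝ≥0∞) (b : ℝ≥0∞) :
      (∑ j, (a j * b) ^ 2) ^ (1 / 2 : ℝ) = (∑ j, a j ^ 2) ^ (1 / 2 : ℝ) * b := by
    simp only [mul_pow, ← Finset.sum_mul]
    rw [ENNReal.mul_rpow_of_nonneg _ _ (by norm_num), ← ENNReal.rpow_natCast b, ← ENNReal.rpow_mul]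
    norm_num
  have minkowski := ENNReal.Lp_add_le Finset.univ (fun j => u j * c) (fun j => v j * w) one_le_two
  simp only [ENNReal.rpow_two, rpow_sum_mul_sq] at minkowski
  simpa only [mul_comm c] using minkowski

section PartialDerivative

variable {n m : ℕ} {S : Set (EuclideanSpace ℝ (Fin n))} {A : Set (EuclideanSpace ℝ (Fin m))}

lemma DiffOn.hasLineDerivAt_pderiv {f : S → ℝ} (hf : DiffOn S f) (hS : IsOpen S) (s : S)
    (j : Fin n) :
    HasLineDerivAt ℝ (zeroExt S f) (pderiv S f s j) s (EuclideanSpace.single j 1) :=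
  ((hf s s.2).differentiableAt (hS.mem_nhds s.2)).hasFDerivAt.hasLineDerivAt _

variable {q : S → A → ℝ}

lemma Lip_pderiv_le_lipGrad (s : S) (j : Fin n) :
    Lip A (fun a => pderiv S (fun s' => q s' a) s j) ≤ lipGrad q s := by
  rw [lipGrad, one_div, ENNReal.le_rpow_inv_iff two_pos, ENNReal.rpow_two]
  exact Finset.single_le_sum
    (f := fun j => Lip A (fun a => pderiv S (fun s' => q s' a) s j) ^ 2)
    (fun _ _ => zero_le) (Finset.mem_univ j)

lemma upperSlope_integral_sub_integral_le_Lip_pderiv (hS : IsOpen S) (hA : Convex ℝ A)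
    (hqs : ∀ a, DiffOn S (fun s => q s a))
    (hqsa : ∀ s j, DiffOn A (fun a => pderiv S (fun s' => q s' a) s j))
    {K : ℝ≥0} (hK : ∀ s, lipGrad q s ≤ K) {ζ ν : Measure A} [IsProbabilityMeasure ζ]
    [IsProbabilityMeasure ν] (hKW : K * W ζ ν ≠ ⊤) (hζ : ∀ s, Integrable (q s) ζ)
    (hν : ∀ s, Integrable (q s) ν) (s : S) (j : Fin n) :
    upperSlope (zeroExt S fun s' => ∫ a, q s' a ∂ζ - ∫ a, q s' a ∂ν) s
        (EuclideanSpace.single j 1) ≤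
      Lip A (fun a => pderiv S (fun s' => q s' a) s j) * W ζ ν := by
  have hmem : ∀ᶠ y in 𝓝 (s : EuclideanSpace ℝ (Fin n)), y ∈ S := hS.mem_nhds s.2
  have hLip (s : S) : Lip A (fun a => pderiv S (fun s' => q s' a) s j) ≤ K :=
    (Lip_pderiv_le_lipGrad s j).trans (hK s)
  rw [upperSlope_congr (g := fun y =>
    ∫ a, zeroExt S (fun s' => q s' a) y ∂ζ - ∫ a, zeroExt S (fun s' => q s' a) y ∂ν)
    (hmem.mono fun y hy => by simp only [zeroExt_of_mem _ hy])]
  refine upperSlope_integral_sub_integral_le (K := K)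
    (q' := fun y a => fderiv ℝ (zeroExt S fun s' => q s' a) y (EuclideanSpace.single j 1))
    (ne_top_of_le_ne_top ENNReal.coe_ne_top (hLip s)) hKW
    (hmem.mono fun y hy a => (hqs a).hasLineDerivAt_pderiv hS ⟨y, hy⟩ j)
    (hmem.mono fun y hy a b => ((hqsa ⟨y, hy⟩ j).edist_le hA a b).trans ?_)
    ((hqsa s j).edist_le hA) (hmem.mono fun y hy => ?_)
  · gcongr
    exact hLip ⟨y, hy⟩
  · simpa only [zeroExt_of_mem _ hy] using ⟨hζ ⟨y, hy⟩, hν ⟨y, hy⟩⟩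

variable {π₁ π₂ : Kernel S A} [IsMarkovKernel π₁] [IsMarkovKernel π₂]

-- The increment splits into one of the two measures, at the fixed integrand `q (s + h eⱼ)`, and one
-- of the integrand, at the fixed measures `π₁ s` and `π₂ s`.
lemma upperSlope_integral_sub_integral_le_mixPartial (hS : IsOpen S) (hA : Convex ℝ A)
    (hq : ∀ s, BoundedMeasurable (q s)) (hqa : ∀ s, DiffOn A (q s))
    (hqs : ∀ a, DiffOn S (fun s => q s a))
    (hqsa : ∀ s j, DiffOn A (fun a => pderiv S (fun s' => q s' a) s j))
    {l K : ℝ≥0} (hl : ∀ s, Lip A (q s) ≤ l) (hK : ∀ s, lipGrad q s ≤ K) (s : S)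
    (hKW : K * W (π₂ s) (π₁ s) ≠ ⊤) (j : Fin n) :
    upperSlope (zeroExt S fun s' => ∫ a, q s' a ∂(π₂ s') - ∫ a, q s' a ∂(π₁ s')) s
        (EuclideanSpace.single j 1) ≤
      2 * l * mixPartial π₁ π₂ s j +
        Lip A (fun a => pderiv S (fun s' => q s' a) s j) * W (π₂ s) (π₁ s) := by
  have hmem : ∀ᶠ h : ℝ in 𝓝[≠] 0,
      (s : EuclideanSpace ℝ (Fin n)) + h • EuclideanSpace.single j 1 ∈ S :=
    (tendsto_add_smul_nhdsNE _ _).eventually (hS.mem_nhds s.2)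
  refine le_trans ?_ (add_le_add_right (upperSlope_integral_sub_integral_le_Lip_pderiv hS hA hqs
    hqsa hK hKW (fun s => (hq s).integrable _) (fun s => (hq s).integrable _) s j) _)
  rw [mixPartial, ← ENNReal.limsup_const_mul_of_ne_top
    (ENNReal.mul_ne_top ENNReal.ofNat_ne_top ENNReal.coe_ne_top)]
  refine le_trans (limsup_le_limsup (hmem.mono fun h hs => ?_))
    (limsup_add_le_limsup_add_limsup _ _)
  have hint (s' : S) (π : Kernel S A) [IsMarkovKernel π] (s'' : S) : Integrable (q s') (π s'') :=
    (hq s').integrable _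
  simp only [dif_pos hs, zeroExt_of_mem _ hs, zeroExt_coe]
  rw [← mul_div_assoc, ← ENNReal.add_div]
  gcongr
  set y : S := ⟨_, hs⟩
  calc ‖(∫ a, q y a ∂(π₂ y) - ∫ a, q y a ∂(π₁ y)) - (∫ a, q s a ∂(π₂ s) - ∫ a, q s a ∂(π₁ s))‖ₑ
      = ‖((∫ a, q y a ∂(π₂ y) - ∫ a, q y a ∂(π₁ y)) -
            (∫ a, q y a ∂(π₂ s) - ∫ a, q y a ∂(π₁ s))) +
          ((∫ a, q y a ∂(π₂ s) - ∫ a, q y a ∂(π₁ s)) -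
            (∫ a, q s a ∂(π₂ s) - ∫ a, q s a ∂(π₁ s)))‖ₑ := by rw [sub_add_sub_cancel]
    _ ≤ _ := enorm_add_le _ _
    _ ≤ _ := by
      gcongr
      refine enorm_integral_sub_integral_sub_le (fun a b => ((hqa y).edist_le hA a b).trans ?_)
        (hint y π₂ s) (hint y π₁ s) (hint y π₂ y) (hint y π₁ y)
      gcongr
      exact hl y

lemma lipschitzWith_integral_sub_integral (hS : IsOpen S) (hSconv : Convex ℝ S)
    (hA : Convex ℝ A) (hq : ∀ s, BoundedMeasurable (q s)) (hqa : ∀ s, DiffOn A (q s))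
    (hqs : ∀ a, DiffOn S (fun s => q s a))
    (hqsa : ∀ s j, DiffOn A (fun a => pderiv S (fun s' => q s' a) s j))
    {l K F : ℝ≥0} (hl : ∀ s, Lip A (q s) ≤ l) (hK : ∀ s, lipGrad q s ≤ K)
    (hKW : ∀ s, K * W (π₂ s) (π₁ s) ≠ ⊤)
    (hF : ∀ s, 2 * l * LG2 π₁ π₂ s ^ (1 / 2 : ℝ) + lipGrad q s * W (π₂ s) (π₁ s) ≤ F) :
    LipschitzWith F fun s => ∫ a, q s a ∂(π₂ s) - ∫ a, q s a ∂(π₁ s) := by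
  have hlip := lipschitzOnWith_of_sum_upperSlope_sq_le (C := F)
    (f := zeroExt S fun s => ∫ a, q s a ∂(π₂ s) - ∫ a, q s a ∂(π₁ s))
    (EuclideanSpace.basisFun (Fin n) ℝ) hS hSconv fun x hx => ?_
  · intro s s'
    simpa only [zeroExt_coe, Subtype.edist_eq] using hlip s.2 s'.2
  · rw [← ENNReal.rpow_two, ← ENNReal.rpow_inv_le_iff two_pos, ← one_div]
    refine le_trans ?_ ((sum_mul_add_mul_sq_rpow_le _ _ _ _).trans (hF ⟨x, hx⟩))
    gcongr with j
    rw [EuclideanSpace.basisFun_apply]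
    exact upperSlope_integral_sub_integral_le_mixPartial hS hA hq hqa hqs hqsa hl hK ⟨x, hx⟩
      (hKW _) j

theorem edist_integral_sub_integral_le (hS : IsOpen S) (hSconv : Convex ℝ S) (hA : Convex ℝ A)
    (hq : ∀ s, BoundedMeasurable (q s)) (hqa : ∀ s, DiffOn A (q s))
    (hqs : ∀ a, DiffOn S (fun s => q s a))
    (hqsa : ∀ s j, DiffOn A (fun a => pderiv S (fun s' => q s' a) s j))
    (hl : ⨆ s, Lip A (q s) ≠ ⊤) (hK : ⨆ s, lipGrad q s ≠ ⊤) (s s' : S) :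
    edist (∫ a, q s a ∂(π₂ s) - ∫ a, q s a ∂(π₁ s))
        (∫ a, q s' a ∂(π₂ s') - ∫ a, q s' a ∂(π₁ s')) ≤
      (2 * (⨆ s, Lip A (q s)) * (⨆ s, LG2 π₁ π₂ s) ^ (1 / 2 : ℝ) +
        (⨆ s, lipGrad q s) * policyW π₂ π₁) * edist s s' := by
  rcases eq_or_ne s s' with rfl | hss'
  · simp
  have hl' := le_iSup fun s => Lip A (q s)
  have hK' := le_iSup (lipGrad q)
  have hW := le_iSup fun s => W (π₂ s) (π₁ s)
  lift (⨆ s, Lip A (q s)) to ℝ≥0 using hl with l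
  lift (⨆ s, lipGrad q s) to ℝ≥0 using hK with K
  rcases eq_or_ne (2 * l * (⨆ s, LG2 π₁ π₂ s) ^ (1 / 2 : ℝ) + K * policyW π₂ π₁) ⊤
    with htop | hfin
  · rw [htop, ENNReal.top_mul (edist_pos.2 hss').ne']
    exact le_top
  have hKw : K * policyW π₂ π₁ ≠ ⊤ := (ENNReal.add_ne_top.1 hfin).2
  rw [← ENNReal.coe_toNNReal hfin]
  refine lipschitzWith_integral_sub_integral hS hSconv hA hq hqa hqs hqsa hl' hK'
    (fun s => ne_top_of_le_ne_top hKw (mul_le_mul_right (hW s) _)) (fun s => ?_) s s'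
  rw [ENNReal.coe_toNNReal hfin]
  gcongr
  · exact le_iSup (LG2 π₁ π₂) s
  · exact hK' s
  · exact hW s

end PartialDerivative

/-! ### The distance of the state distributions -/

lemma sum_ofReal_pow_le {γ : ℝ} (hγ : 0 ≤ γ) (hγ1 : γ < 1) (N : ℕ) :
    ∑ t ∈ Finset.range N, ENNReal.ofReal (γ ^ t) ≤ ENNReal.ofReal (1 - γ)⁻¹ := by
  rw [← ENNReal.ofReal_sum_of_nonneg fun t _ => pow_nonneg hγ t, ← tsum_geometric_of_lt_one hγ hγ1]
  exact ENNReal.ofReal_le_ofReal <|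
    (summable_geometric_of_lt_one hγ hγ1).sum_le_tsum _ fun t _ => pow_nonneg hγ t

lemma tsum_ofReal_pow_mul_le {d : ℕ → ℝ≥0∞} {b : ℝ≥0∞} {L : ℝ≥0} {γ : ℝ} (hd : d 0 = 0)
    (hrec : ∀ t, d (t + 1) ≤ b + L * d t) (hγ : 0 ≤ γ) (hγ1 : γ < 1) (hγL : γ * L < 1) :
    ∑' t, ENNReal.ofReal (γ ^ t) * d t ≤ ENNReal.ofReal (γ / ((1 - γ) * (1 - γ * L))) * b := by
  have hγ_pos : 0 < 1 - γ := sub_pos.2 hγ1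
  have hγL_pos : 0 < 1 - γ * L := sub_pos.2 hγL
  set κ := γ / ((1 - γ) * (1 - γ * L)) with hκ
  have hfix : γ * (1 - γ)⁻¹ + γ * L * κ = κ := by
    rw [hκ]
    field_simp
    ring
  refine ENNReal.tsum_le_of_sum_range_le fun N => ?_
  induction N with
  | zero => simp
  | succ N ih =>
    calc ∑ t ∈ Finset.range (N + 1), ENNReal.ofReal (γ ^ t) * d t
        = ∑ t ∈ Finset.range N, ENNReal.ofReal γ * (ENNReal.ofReal (γ ^ t) * d (t + 1)) := by
          simp_rw [Finset.sum_range_succ', hd, mul_zero, add_zero, pow_succ', ENNReal.ofReal_mul hγ,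
            mul_assoc]
      _ ≤ ∑ t ∈ Finset.range N, ENNReal.ofReal γ * (ENNReal.ofReal (γ ^ t) * (b + L * d t)) := by
          gcongr with t
          exact hrec t
      _ = ENNReal.ofReal γ * (∑ t ∈ Finset.range N, ENNReal.ofReal (γ ^ t)) * b +
            ENNReal.ofReal γ * L * ∑ t ∈ Finset.range N, ENNReal.ofReal (γ ^ t) * d t := by
          simp_rw [Finset.mul_sum, Finset.sum_mul, ← Finset.sum_add_distrib]
          exact Finset.sum_congr rfl fun t _ => by ring
      _ ≤ ENNReal.ofReal γ * ENNReal.ofReal (1 - γ)⁻¹ * b +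
            ENNReal.ofReal γ * L * (ENNReal.ofReal κ * b) := by
          gcongr
          exact sum_ofReal_pow_le hγ hγ1 N
      _ = ENNReal.ofReal κ * b := by
          rw [← ENNReal.ofReal_coe_nnreal, ← mul_assoc, ← add_mul, ← ENNReal.ofReal_mul hγ,
            ← ENNReal.ofReal_mul hγ, ← ENNReal.ofReal_mul (by positivity),
            ← ENNReal.ofReal_add (by positivity) (by positivity), hfix]

lemma sum_Icc_one_eq_sum_range (p q : ℕ → ℝ≥0∞) (t : ℕ) :
    ∑ k ∈ Finset.Icc 1 t, p (t - k) * ∏ i ∈ Finset.Icc 1 (k - 1), q (t - i) =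
      ∑ k ∈ Finset.range t, p (t - (k + 1)) * ∏ i ∈ Finset.range k, q (t - (i + 1)) := by
  have hI (t : ℕ) : Finset.Icc 1 t = Finset.Ico 1 (t + 1) := by ext; simp
  simp only [hI, Finset.sum_Ico_eq_sum_range, Finset.prod_Ico_eq_prod_range, Nat.add_sub_cancel,
    add_comm 1]

lemma sum_Icc_one_succ (p q : ℕ → ℝ≥0∞) (t : ℕ) :
    ∑ k ∈ Finset.Icc 1 (t + 1), p (t + 1 - k) * ∏ i ∈ Finset.Icc 1 (k - 1), q (t + 1 - i) =
      p t + q t * ∑ k ∈ Finset.Icc 1 t, p (t - k) * ∏ i ∈ Finset.Icc 1 (k - 1), q (t - i) := by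
  rw [sum_Icc_one_eq_sum_range, sum_Icc_one_eq_sum_range, Finset.sum_range_succ', Finset.mul_sum,
    add_comm]
  simp only [Finset.prod_range_succ', Nat.add_sub_add_right, Finset.range_zero, Finset.prod_empty,
    mul_one, Nat.sub_zero, zero_add, Nat.add_sub_cancel]
  congr 1
  exact Finset.sum_congr rfl fun k _ => by ring

lemma le_sInf_mul {x w : ℝ≥0∞} (hw : w ≠ ⊤) (h0 : w = 0 → x = 0) :
    x ≤ sInf {L | x = L * w} * w := by
  rcases eq_or_ne w 0 with rfl | hw0
  · simp [h0 rfl]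
  · rw [← ENNReal.div_le_iff hw0 hw]
    exact le_sInf fun L hL => (ENNReal.div_le_iff hw0 hw).2 (le_of_eq hL)

namespace MDP

variable {X Y : Type*} [MeasurableSpace X] [MeasurableSpace Y] (M : MDP X Y) {π₁ π₂ : Kernel X Y}
  [IsMarkovKernel π₁]

lemma stepN_eq_of_forall_step_eq
    (h : ∀ ν : Measure X, IsProbabilityMeasure ν → M.step π₁ ν = M.step π₂ ν) (t : ℕ) :
    M.stepN π₁ M.μ t = M.stepN π₂ M.μ t := by
  induction t with
  | zero => rfl
  | succ t ih => rw [stepN, stepN, ← ih, h _ inferInstance]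

lemma W_step_le_ratePolicy_mul [PseudoEMetricSpace X] [PseudoEMetricSpace Y] {Lπ : ℝ≥0}
    (hLπ : M.PolicyLipschitz π₁ π₂ Lπ) (hw : policyW π₁ π₂ ≠ ⊤) (t : ℕ) :
    W (M.step π₁ (M.stepN π₁ M.μ t)) (M.step π₂ (M.stepN π₁ M.μ t)) ≤
      M.ratePolicy π₁ π₂ t * policyW π₁ π₂ :=
  le_sInf_mul hw fun h0 => by simpa [h0] using hLπ (M.stepN π₁ M.μ t) inferInstance

variable [PseudoEMetricSpace X] [BorelSpace X] [SecondCountableTopology X] [IsMarkovKernel π₂]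

lemma W_stepN_succ_le [StandardBorelSpace X] (t : ℕ) :
    W (M.stepN π₁ M.μ (t + 1)) (M.stepN π₂ M.μ (t + 1)) ≤
      W (M.step π₁ (M.stepN π₁ M.μ t)) (M.step π₂ (M.stepN π₁ M.μ t)) +
        W (M.step π₂ (M.stepN π₁ M.μ t)) (M.step π₂ (M.stepN π₂ M.μ t)) :=
  W_triangle _ _ _

lemma W_step_le_rateState_mul {t : ℕ} (h : W (M.stepN π₁ M.μ t) (M.stepN π₂ M.μ t) ≠ ⊤) :
    W (M.step π₂ (M.stepN π₁ M.μ t)) (M.step π₂ (M.stepN π₂ M.μ t)) ≤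
      M.rateState π₁ π₂ t * W (M.stepN π₁ M.μ t) (M.stepN π₂ M.μ t) :=
  le_sInf_mul h fun h0 => by rw [eq_of_W_eq_zero h0, W_self]

variable [PseudoEMetricSpace Y] {Lπ : ℝ≥0}

lemma W_stepN_eq_zero (hLπ : M.PolicyLipschitz π₁ π₂ 0) (t : ℕ) :
    W (M.stepN π₁ M.μ t) (M.stepN π₂ M.μ t) = 0 := by
  rw [M.stepN_eq_of_forall_step_eq fun ν hν => eq_of_W_eq_zero (by simpa using hLπ ν hν), W_self]

variable [StandardBorelSpace X]

lemma W_stepN_le_stabilityConst_mul (hLπ : M.PolicyLipschitz π₁ π₂ Lπ)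
    (hw : policyW π₁ π₂ ≠ ⊤) (hC : M.stabilityConst π₁ π₂ ≠ ⊤) (t : ℕ) :
    W (M.stepN π₁ M.μ t) (M.stepN π₂ M.μ t) ≤ M.stabilityConst π₁ π₂ * policyW π₁ π₂ := by
  have hle (t : ℕ) : ∑ k ∈ Finset.Icc 1 t, M.ratePolicy π₁ π₂ (t - k) *
      ∏ i ∈ Finset.Icc 1 (k - 1), M.rateState π₁ π₂ (t - i) ≤ M.stabilityConst π₁ π₂ :=
    le_iSup (fun t : ℕ => ∑ k ∈ Finset.Icc 1 t, M.ratePolicy π₁ π₂ (t - k) *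
      ∏ i ∈ Finset.Icc 1 (k - 1), M.rateState π₁ π₂ (t - i)) t
  refine le_trans ?_ (mul_le_mul_left (hle t) _)
  induction t with
  | zero => simp [stepN, W_self]
  | succ t ih =>
    rw [sum_Icc_one_succ (M.ratePolicy π₁ π₂) (M.rateState π₁ π₂), add_mul, mul_assoc]
    have hfin : W (M.stepN π₁ M.μ t) (M.stepN π₂ M.μ t) ≠ ⊤ :=
      ne_top_of_le_ne_top (ENNReal.mul_ne_top hC hw) (ih.trans (mul_le_mul_left (hle t) _))
    refine (M.W_stepN_succ_le t).trans (add_le_add (M.W_step_le_ratePolicy_mul hLπ hw t) ?_)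
    exact (M.W_step_le_rateState_mul hfin).trans (mul_le_mul_right ih _)

lemma W_stepN_le_of_stabilityConst_le (hLπ : M.PolicyLipschitz π₁ π₂ Lπ) {C : ℝ≥0} (hC0 : C ≠ 0)
    (hC : M.stabilityConst π₁ π₂ ≤ Lπ * C) (t : ℕ) :
    W (M.stepN π₁ M.μ t) (M.stepN π₂ M.μ t) ≤ C * (Lπ * policyW π₁ π₂) := by
  rcases eq_or_ne Lπ 0 with rfl | hLπ0
  · simp [M.W_stepN_eq_zero hLπ]
  rcases eq_or_ne (policyW π₁ π₂) ⊤ with hw | hw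
  · simp [hw, hLπ0, hC0]
  · rw [← mul_assoc, mul_comm (C : ℝ≥0∞)]
    refine (M.W_stepN_le_stabilityConst_mul hLπ hw ?_ t).trans (mul_le_mul_left hC _)
    exact ne_top_of_le_ne_top (ENNReal.mul_ne_top ENNReal.coe_ne_top ENNReal.coe_ne_top) hC

lemma tsum_ofReal_pow_mul_W_stepN_le_of_stateLipschitz (hLπ : M.PolicyLipschitz π₁ π₂ Lπ)
    {Lμ : ℝ≥0} (hγL : M.γ * Lμ < 1) (hLμ : M.StateLipschitz π₂ Lμ) :
    ∑' t, ENNReal.ofReal (M.γ ^ t) * W (M.stepN π₁ M.μ t) (M.stepN π₂ M.μ t) ≤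
      ENNReal.ofReal (M.γ * Lπ / ((1 - M.γ) * (1 - M.γ * Lμ))) * policyW π₁ π₂ := by
  have hγ_pos : 0 < 1 - M.γ := sub_pos.2 M.γ_lt_one
  have hγL_pos : 0 < 1 - M.γ * Lμ := sub_pos.2 hγL
  refine (tsum_ofReal_pow_mul_le (b := Lπ * policyW π₁ π₂) (W_self _)
    (fun t => (M.W_stepN_succ_le t).trans (add_le_add (hLπ _ inferInstance)
      (hLμ _ _ inferInstance inferInstance))) M.γ_nonneg M.γ_lt_one hγL).trans_eq ?_
  rw [← mul_assoc, ← ENNReal.ofReal_coe_nnreal,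
    ← ENNReal.ofReal_mul (div_nonneg M.γ_nonneg (mul_pos hγ_pos hγL_pos).le)]
  congr 2
  ring

lemma tsum_ofReal_pow_mul_W_stepN_le_of_stabilityConst_le (hLπ : M.PolicyLipschitz π₁ π₂ Lπ)
    {L : ℝ} (hγL : |M.γ * L| < 1)
    (hC : M.stabilityConst π₁ π₂ ≤ ENNReal.ofReal (Lπ * ∑' t : ℕ, (M.γ * L) ^ t)) :
    ∑' t, ENNReal.ofReal (M.γ ^ t) * W (M.stepN π₁ M.μ t) (M.stepN π₂ M.μ t) ≤
      ENNReal.ofReal (M.γ * Lπ / ((1 - M.γ) * (1 - M.γ * L))) * policyW π₁ π₂ := by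
  have hγ_pos : 0 < 1 - M.γ := sub_pos.2 M.γ_lt_one
  have hγL_pos : 0 < 1 - M.γ * L := sub_pos.2 (abs_lt.1 hγL).2
  have hγ := M.γ_nonneg
  rw [tsum_geometric_of_abs_lt_one hγL, ENNReal.ofReal_mul Lπ.coe_nonneg,
    ENNReal.ofReal_coe_nnreal] at hC
  have hW := M.W_stepN_le_of_stabilityConst_le hLπ (C := (1 - M.γ * L)⁻¹.toNNReal)
    (Real.toNNReal_pos.2 (by positivity)).ne' hC
  have hsum := tsum_ofReal_pow_mul_le (d := fun t => W (M.stepN π₁ M.μ t) (M.stepN π₂ M.μ t))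
    (L := 0) (W_self _) (fun t => (hW (t + 1)).trans le_self_add) hγ M.γ_lt_one (by simp)
  simp only [NNReal.coe_zero, mul_zero, sub_zero, mul_one] at hsum
  refine hsum.trans_eq ?_
  rw [← ENNReal.ofReal, ← mul_assoc, ← mul_assoc, ← ENNReal.ofReal_coe_nnreal,
    ← ENNReal.ofReal_mul (by positivity), ← ENNReal.ofReal_mul (by positivity)]
  congr 2
  field_simp

end MDP

/-! ### The payoff bound -/

lemma mul_le_ofReal_mul_sq_add_ofReal_mul_sq {α : ℝ} (hα : α ≠ 0) (g w : ℝ≥0∞) :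
    g * w ≤ ENNReal.ofReal (α ^ 2 / 2) * g ^ 2 + ENNReal.ofReal (1 / (2 * α ^ 2)) * w ^ 2 := by
  set c := ENNReal.ofReal |α| with hc
  have hc0 : c ≠ 0 := (ENNReal.ofReal_pos.2 (abs_pos.2 hα)).ne'
  have hc2 : c ^ 2 = ENNReal.ofReal (α ^ 2) := by
    rw [hc, ← ENNReal.ofReal_pow (abs_nonneg α), sq_abs]
  have hα2 : 0 < α ^ 2 := by positivity
  calc g * w = c * g * (c⁻¹ * w) := by
        rw [mul_mul_mul_comm, ENNReal.mul_inv_cancel hc0 ENNReal.ofReal_ne_top, one_mul]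
    _ ≤ (c * g) ^ 2 / 2 + (c⁻¹ * w) ^ 2 / 2 := by
        simpa using ENNReal.young_inequality (c * g) (c⁻¹ * w) .two_two
    _ = c ^ 2 / 2 * g ^ 2 + (c ^ 2)⁻¹ / 2 * w ^ 2 := by
        simp only [mul_pow, ENNReal.inv_pow, div_eq_mul_inv, mul_right_comm]
    _ = _ := by
        rw [hc2, ← ENNReal.ofReal_inv_of_pos hα2, ← ENNReal.ofReal_ofNat 2,
          ← ENNReal.ofReal_div_of_pos two_pos, ← ENNReal.ofReal_div_of_pos two_pos, one_div,
          mul_inv_rev, div_eq_mul_inv (α ^ 2)⁻¹]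

variable {n m : ℕ} {S : Set (EuclideanSpace ℝ (Fin n))} {A : Set (EuclideanSpace ℝ (Fin m))}

lemma C₁'_eq (M : MDP S A) (π₁ : Kernel S A) (Lπ : ℝ≥0) (L : ℝ) :
    C₁' M π₁ Lπ L = 2 * (⨆ s, Lip A (M.Q π₁ s)) *
      ENNReal.ofReal (M.γ * Lπ / ((1 - M.γ) * (1 - M.γ * L))) := by
  rw [C₁', ← ENNReal.iSup_mul, ENNReal.mul_iSup]

lemma C₂'_eq (M : MDP S A) (π₁ : Kernel S A) (Lπ : ℝ≥0) (L : ℝ) :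
    C₂' M π₁ Lπ L = (⨆ s, lipGrad (M.Q π₁) s) *
      ENNReal.ofReal (M.γ * Lπ / ((1 - M.γ) * (1 - M.γ * L))) := by
  rw [C₂', ← ENNReal.iSup_mul]

lemma policyW_sq (π₁ π₂ : Kernel S A) :
    policyW π₁ π₂ ^ 2 = ⨆ s, W (π₁ s) (π₂ s) ^ 2 :=
  ENNReal.iSup_pow_of_ne_zero two_ne_zero _

lemma coeff_mul_le (M : MDP S A) (π₁ : Kernel S A) (Lπ : ℝ≥0) (L : ℝ) {α : ℝ} (hα : α ≠ 0)
    (G w : ℝ≥0∞) :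
    (2 * (⨆ s, Lip A (M.Q π₁ s)) * G ^ (1 / 2 : ℝ) + (⨆ s, lipGrad (M.Q π₁) s) * w) *
        (ENNReal.ofReal (M.γ * Lπ / ((1 - M.γ) * (1 - M.γ * L))) * w) ≤
      C₁ M π₁ Lπ L α * G + C₂ M π₁ Lπ L α * w ^ 2 := by
  have hG : (G ^ (1 / 2 : ℝ)) ^ 2 = G := by
    rw [← ENNReal.rpow_natCast, ← ENNReal.rpow_mul]; norm_num
  calc _ = C₁' M π₁ Lπ L * (G ^ (1 / 2 : ℝ) * w) + C₂' M π₁ Lπ L * w ^ 2 := by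
        rw [C₁'_eq, C₂'_eq]; ring
    _ ≤ C₁' M π₁ Lπ L * (ENNReal.ofReal (α ^ 2 / 2) * (G ^ (1 / 2 : ℝ)) ^ 2 +
          ENNReal.ofReal (1 / (2 * α ^ 2)) * w ^ 2) + C₂' M π₁ Lπ L * w ^ 2 := by
        gcongr
        exact mul_le_ofReal_mul_sq_add_ofReal_mul_sq hα _ _
    _ = _ := by
        rw [hG, C₁, C₂]; ring

lemma coe_sub_sub_le_of_enorm_sub_le {x y : ℝ} {a b : ℝ≥0∞} (h : ‖y - x‖ₑ ≤ a + b) :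
    (x : EReal) - a - b ≤ y := by
  have hxy : (x : EReal) ≤ y + (‖y - x‖ₑ : ℝ≥0∞) := by
    rw [← ofReal_norm, EReal.coe_ennreal_ofReal, max_eq_left (norm_nonneg _), ← EReal.coe_add,
      EReal.coe_le_coe_iff, ← sub_le_iff_le_add', ← neg_sub]
    exact neg_le_abs _
  refine EReal.sub_le_of_le_add (EReal.sub_le_of_le_add ?_)
  calc (x : EReal) ≤ y + (a + b : ℝ≥0∞) := hxy.trans (by gcongr; exact_mod_cast h)
    _ = y + b + a := by rw [EReal.coe_ennreal_add, add_comm (a : EReal), add_assoc]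

end TDPO

open TDPO in
theorem mainTheorem1_general {n m : ℕ}
    {S : Set (EuclideanSpace ℝ (Fin n))} (hSopen : IsOpen S) (hSconv : Convex ℝ S)
    {A : Set (EuclideanSpace ℝ (Fin m))} (hAconv : Convex ℝ A)
    (M : MDP S A) (π₁ π₂ : Kernel S A) [IsMarkovKernel π₁] [IsMarkovKernel π₂]
    (hQa : ∀ s, DiffOn A (M.Q π₁ s))
    (hQs : ∀ a, DiffOn S (fun s => M.Q π₁ s a))
    (hQsa : ∀ s j, DiffOn A (fun a => pderiv S (fun s' => M.Q π₁ s' a) s j))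
    (hLip : (⨆ s, Lip A (M.Q π₁ s)) ≠ ⊤) (hLipGrad : (⨆ s, lipGrad (M.Q π₁) s) ≠ ⊤)
    (Lπ : ℝ≥0) (hLπ : M.PolicyLipschitz π₁ π₂ Lπ) (L : ℝ)
    (hL : (∃ Lμ : ℝ≥0, L = Lμ ∧ M.γ * Lμ < 1 ∧ M.StateLipschitz π₂ Lμ) ∨
      (|M.γ * L| < 1 ∧
        M.stabilityConst π₁ π₂ ≤ ENNReal.ofReal (Lπ * ∑' t : ℕ, (M.γ * L) ^ t)))
    {α : ℝ} (hα : α ≠ 0) :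
    ‖M.payoff π₂ - (M.payoff π₁ +
        1 / (1 - M.γ) * ∫ s, M.adv π₁ s π₂ ∂(M.visitation π₁ M.μ))‖ₑ ≤
      C₁ M π₁ Lπ L α * (⨆ s, LG2 π₁ π₂ s) + C₂ M π₁ Lπ L α * ⨆ s, W (π₂ s) (π₁ s) ^ 2 := by
  have : StandardBorelSpace S := hSopen.measurableSet.standardBorel
  have hadv := edist_integral_sub_integral_le (π₁ := π₁) (π₂ := π₂) hSopen hSconv hAconv
    (M.boundedMeasurable_Q_apply π₁) hQa hQs hQsa hLip hLipGrad
  simp only [← M.adv_eq_integral_Q_sub_integral_Q] at hadv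
  have hdist : ∑' t, ENNReal.ofReal (M.γ ^ t) * W (M.stepN π₁ M.μ t) (M.stepN π₂ M.μ t) ≤
      ENNReal.ofReal (M.γ * Lπ / ((1 - M.γ) * (1 - M.γ * L))) * policyW π₁ π₂ := by
    rcases hL with ⟨Lμ, rfl, hγL, hLμ⟩ | ⟨hγL, hC⟩
    · exact M.tsum_ofReal_pow_mul_W_stepN_le_of_stateLipschitz hLπ hγL hLμ
    · exact M.tsum_ofReal_pow_mul_W_stepN_le_of_stabilityConst_le hLπ hγL hC
  simp only [W_comm (M.stepN π₁ M.μ _), policyW_comm π₁] at hdist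
  rw [← policyW_sq]
  exact (M.enorm_payoff_sub_le π₁ π₂ hadv).trans <| (mul_le_mul_right hdist _).trans <|
    coeff_mul_le M π₁ Lπ L hα _ _

open MeasureTheory ProbabilityTheory TDPO in
theorem mainTheorem1 {n m : ℕ}
    (S : Set (EuclideanSpace ℝ (Fin n))) (hSopen : IsOpen S) (hSconv : Convex ℝ S)
    (A : Set (EuclideanSpace ℝ (Fin m))) (hAconv : Convex ℝ A)
    (M : MDP S A) (π₁ π₂ : Kernel S A) [IsMarkovKernel π₁] [IsMarkovKernel π₂]
    -- existence of the gradients and Lipschitz constants of `Q^{π₁}`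
    (hQa : ∀ s, DiffOn A (M.Q π₁ s))
    (hQs : ∀ a, DiffOn S (fun s => M.Q π₁ s a))
    (hQsa : ∀ s j, DiffOn A (fun a => pderiv S (fun s' => M.Q π₁ s' a) s j))
    (hLip : (⨆ s, Lip A (M.Q π₁ s)) ≠ ⊤)
    (hLipGrad : (⨆ s, lipGrad (M.Q π₁) s) ≠ ⊤)
    -- the dynamics is Lipschitz in the policy
    (Lπ : NNReal) (hLπ : M.PolicyLipschitz π₁ π₂ Lπ)
    -- either it is `L`-Lipschitz in the state distribution with `γ L < 1`,
    -- or it is stable, `L` being the effective constant with `C_L ≤ L_π ∑ₜ (γ L)ᵗ`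
    (L : ℝ)
    (hL : (∃ Lμ : NNReal, L = Lμ ∧ M.γ * Lμ < 1 ∧
            M.StateLipschitz π₁ Lμ ∧ M.StateLipschitz π₂ Lμ) ∨
          (|M.γ * L| < 1 ∧
            M.stabilityConst π₁ π₂ ≤ ENNReal.ofReal (Lπ * ∑' t : ℕ, (M.γ * L) ^ t)))
    (α : ℝ) (hα : α ≠ 0) :
    surrogate M π₁ π₂ Lπ L α ≤ (M.payoff π₂ : EReal) := by
  have hgen := mainTheorem1_general hSopen hSconv hAconv M π₁ π₂ hQa hQs hQsa hLip hLipGrad Lπ hLπ L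
    (hL.imp_left fun ⟨Lμ, h, hγL, _, hLμ⟩ => ⟨Lμ, h, hγL, hLμ⟩) hα
  exact coe_sub_sub_le_of_enorm_sub_le hgen
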